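/- Let $2^\omega$ be Cantor space, with the basic clopen sets $[\sigma]$ ($\sigma$ a finite binary word), and let $X\oplus Y$ denote the join of $X,Y\in 2^\omega$. For $Z\in 2^\omega$, a sequence $(V_n)_{n\in\mathbb N}$ of subsets of $2^\omega$ (respectively of $2^\omega\times 2^\omega$) is uniformly $\Sigma^0_1(Z)$ if there are sets $W_n$ of words (respectively of pairs of words), r.e. in $Z$ uniformly in $n$, with $V_n=\bigcup_{\sigma\in W_n}[\sigma]$ (respectively $V_n=\bigcup_{(\sigma,\tau)\in W_n}[\sigma]\times[\tau]$). Borel probability measures on $2^\omega$ are represented by reals through the following continuous surjection $\rho$ of $2^\omega$ onto the space of Borel probability measures on $2^\omega$ with the weak-$*$ topology. Let $r\colon 2^\omega\to[0,1]$ send $b$ to the average of the two numbers with binary expansions $0.b_0b_2b_4\ldots$ and $0.b_1b_3b_5\ldots$, and for $R\in 2^\omega$ and a finite word $\sigma$ let $R^{[\sigma]}$ be the column of $R$ with the code of $\sigma$ as its index (for a fixed computable coding). Then $\rho(R)$ is the probability measure with $$\rho(R)[\sigma 0]=\min\bigl(r(R^{[\sigma]}),\ \rho(R)[\sigma]\bigr)\quad\text{for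 all }\sigma .$$ (Up to computable translation of names, this is the representation of measures by fast Cauchy sequences of rational combinations of Dirac measures.) A representation of $\mu$ is any $R$ with $\rho(R)=\mu$. For a representation $R$ of $\mu$ and $A\in 2^\omega$, an $(R,A)$-test is a uniformly $\Sigma^0_1(R\oplus A)$ sequence $(V_n)$ of subsets of $2^\omega$ with $\mu(V_n)\le 2^{-n}$ for all $n$. Let $\mathrm{MLR}_\mu(A)$ be the set of all $X\in 2^\omega$ for which there is a representation $R$ of $\mu$ such that $X\notin\bigcap_n V_n$ for every $(R,A)$-test $(V_n)$. Likewise, let $\mathrm{MLR}_{\mu\times\mu}$ be the set of all pairs $(X,Y)\in 2^\omega\times 2^\omega$ for which there is a representation $R$ of $\mu$ such that $(X,Y)\notin\bigcap_n V_n$ for every uniformly $\Sigma^0_1(R\oplus\emptyset)$ sequence $(V_n)$ of subsets of $2^\omega\times 2^\omega$ with $(\mu\times\mu)(V_n)\le 2^{-n}$ for all $n$. **Corollary.** Let $\mu$ be a Borel probability measure on $2^\omega$ (not necessarily computable) and let $A,B\in 2^\omega$. Then $A$ and $B$ are relatively random with respect to $\mu$, that is, $A\in\mathrm{MLR}_\mu(B)$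 and $B\in\mathrm{MLR}_\mu(A)$ (possibly witnessed by different representations of $\mu$), if and only if $(A,B)\in\mathrm{MLR}_{\mu\times\mu}$. -/

import Mathlib

namespace CantorRandom

open MeasureTheory

/-! ### Cantor space, words, joins -/

/-- Cantor space `2^ω`. Its elements are called reals; a set of natural numbers is identified with
its characteristic function. -/
abbrev Cantor : Type := ℕ → Bool

/-- The basic clopen set `[σ]` of all `X` that extend the finite word `σ`. Words are lists of bits
with the *latest* bit first, as in `PiNat.res`: `PiNat.res X n = [X (n-1), …, X 1, X 0]`. -/
def cyl (σ : List Bool) : Set Cantor := {X | PiNat.res X σ.length = σ}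

/-- The join `X ⊕ Y`: `X` on the even places, `Y` on the odd places. -/
def join (X Y : Cantor) : Cantor := fun n => if n % 2 = 0 then X (n / 2) else Y (n / 2)

/-- The empty set as an element of Cantor space. -/
def emptyReal : Cantor := fun _ => false

/-! ### Relative enumerability -/

/-- The characteristic function of `Z`, as an oracle. -/
def oracle (Z : Cantor) : ℕ →. ℕ := fun n => Part.some (Z n).toNat

/-- `p` is recursively enumerable in `Z`: it is the domain of a partial function which is recursive
in `Z` (the relativization of `REPred`). -/
def REIn {α : Type*} [Primcodable α] (Z : Cantor) (p : α → Prop) : Prop :=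
  RecursiveIn {oracle Z} fun a => Part.assert (p a) fun _ => Part.some ()

/-- `(V n)` is a sequence of uniformly `Σ⁰₁(Z)` classes in Cantor space: there is a sequence of sets
of words `W n`, uniformly r.e. in `Z`, such that `V n` is the union of the `[σ]`, `σ ∈ W n`. -/
def UniformlySigmaOne (Z : Cantor) (V : ℕ → Set Cantor) : Prop :=
  ∃ W : ℕ → Set (List Bool),
    REIn Z (fun q : ℕ × List Bool => q.2 ∈ W q.1) ∧ ∀ n, V n = ⋃ σ ∈ W n, cyl σ

/-- `(V n)` is a sequence of uniformly `Σ⁰₁(Z)` classes in the product of two copies of Cantor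
space, whose basic clopen sets are the rectangles `[σ] × [τ]`. -/
def UniformlySigmaOneProd (Z : Cantor) (V : ℕ → Set (Cantor × Cantor)) : Prop :=
  ∃ W : ℕ → Set (List Bool × List Bool),
    REIn Z (fun q : ℕ × (List Bool × List Bool) => q.2 ∈ W q.1) ∧
      ∀ n, V n = ⋃ στ ∈ W n, cyl στ.1 ×ˢ cyl στ.2

/-! ### Representations of measures

A real `R` codes a probability measure `rho R` on Cantor space. The columns of `R` name real numbers
`column R σ ∈ [0,1]`, one for each word `σ`, in a redundant binary notation (the average of two
binary expansions; this is the signed-digit notation, rescaled to `[0,1]`). The measure is obtained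
by letting `[σ0]` have the measure `column R σ`, cut down to the measure of `[σ]` if it is larger,
and giving the rest of the measure of `[σ]` to `[σ1]`.

Every real is the representation of a measure, the measures of the cylinders are computable from the
representation, uniformly, and conversely a representation can be computed from any sequence of
rational approximations, with known error, to the measures of the cylinders, or equivalently from
any fast Cauchy sequence of rational combinations of Dirac measures that converges to the measure:
this is why the notation for real numbers has to be redundant. So `rho` is, up to computable
translation of the names, the representation of measures by Cauchy sequences of basic measures. It is
continuous (`continuous_rho`), onto (`rho_surjective`), and `{S | rho S = rho R}` is a `Π⁰₁(R)`
class. -/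

/-- The number in `[0,1]` with the redundant binary name `b`: the average of the numbers with
binary expansions `0.b₀b₂b₄…` and `0.b₁b₃b₅…`. -/
noncomputable def nameVal (b : ℕ → Bool) : ℝ :=
  (Real.ofDigits (fun k => if b (2 * k) then (1 : Fin 2) else 0) +
    Real.ofDigits (fun k => if b (2 * k + 1) then (1 : Fin 2) else 0)) / 2

/-- The number named by the column of `R` that belongs to the word `σ`. -/
noncomputable def column (R : Cantor) (σ : List Bool) : ℝ :=
  nameVal fun k => R (Nat.pair (Encodable.encode σ) k)

/-- The measure of the cylinder `[σ]` with respect to the measure coded by `R`. -/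
noncomputable def mass (R : Cantor) : List Bool → ℝ
  | [] => 1
  | false :: σ => min (column R σ) (mass R σ)
  | true :: σ => mass R σ - min (column R σ) (mass R σ)

/-- The total mass of the cylinders of the same length to the left of `[σ]`. -/
noncomputable def leftEnd (R : Cantor) : List Bool → ℝ
  | [] => 0
  | false :: σ => leftEnd R σ
  | true :: σ => leftEnd R σ + mass R (false :: σ)

/-- The word of length `n` whose interval `[leftEnd R σ, leftEnd R σ + mass R σ)` contains
`u ∈ [0,1)`. -/
noncomputable def wordAt (R : Cantor) (u : ℝ) : ℕ → List Bool
  | 0 => []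
  | n + 1 => decide (leftEnd R (wordAt R u n) + mass R (false :: wordAt R u n) ≤ u) :: wordAt R u n

/-- The real all of whose initial segments have intervals that contain `u`. -/
noncomputable def pathAt (R : Cantor) (u : ℝ) : Cantor := fun n =>
  decide (leftEnd R (wordAt R u n) + mass R (false :: wordAt R u n) ≤ u)

lemma nameVal_nonneg (b : ℕ → Bool) : 0 ≤ nameVal b := by
  unfold nameVal
  have h1 := Real.ofDigits_nonneg (fun k => if b (2 * k) then (1 : Fin 2) else 0)
  have h2 := Real.ofDigits_nonneg (fun k => if b (2 * k + 1) then (1 : Fin 2) else 0)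
  linarith

lemma mass_nonneg (R : Cantor) (σ : List Bool) : 0 ≤ mass R σ := by
  induction σ with
  | nil => simp [mass]
  | cons b σ ih =>
    cases b
    · exact le_min (nameVal_nonneg _) ih
    · simp only [mass]
      linarith [min_le_right (column R σ) (mass R σ)]

lemma mass_add (R : Cantor) (σ : List Bool) :
    mass R (false :: σ) + mass R (true :: σ) = mass R σ := by
  simp [mass]

lemma res_pathAt (R : Cantor) (u : ℝ) (n : ℕ) : PiNat.res (pathAt R u) n = wordAt R u n := by
  induction n with
  | zero => rfl
  | succ n ih => rw [PiNat.res_succ, ih]; rfl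

lemma pathAt_mem_cyl (R : Cantor) {u : ℝ} (hu : u ∈ Set.Ico (0 : ℝ) 1) (σ : List Bool) :
    pathAt R u ∈ cyl σ ↔ u ∈ Set.Ico (leftEnd R σ) (leftEnd R σ + mass R σ) := by
  simp only [cyl, Set.mem_ofPred_eq, res_pathAt]
  induction σ with
  | nil => simpa [wordAt, leftEnd, mass] using hu
  | cons b σ ih =>
    have h0 := mass_nonneg R (false :: σ)
    have h1 := mass_nonneg R (true :: σ)
    have h2 := mass_add R σ
    simp only [List.length_cons, wordAt, List.cons.injEq]
    constructor
    · rintro ⟨hb, hw⟩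
      have := ih.1 hw
      rw [hw] at hb
      cases b
      · simp only [decide_eq_false_iff_not, not_le] at hb
        exact ⟨this.1, hb⟩
      · simp only [decide_eq_true_eq] at hb
        refine ⟨hb, ?_⟩
        have := this.2
        simp only [leftEnd]
        linarith
    · intro h
      have hw : wordAt R u σ.length = σ := by
        apply ih.2
        cases b
        · exact ⟨h.1, by have := h.2; simp only [leftEnd] at this; linarith⟩
        · have h3 := h.1
          have h4 := h.2
          simp only [leftEnd] at h3 h4
          exact ⟨by linarith, by linarith⟩
      refine ⟨?_, hw⟩
      rw [hw]
      cases b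
      · simpa [leftEnd] using h.2
      · simpa [leftEnd] using h.1

lemma isClopen_cyl (σ : List Bool) : IsClopen (cyl σ) := by
  have h : ∀ n, Continuous fun X : Cantor => PiNat.res X n := by
    intro n
    induction n with
    | zero => exact continuous_const
    | succ n ih =>
      have : Continuous fun X : Cantor => (X n, PiNat.res X n) := (continuous_apply n).prodMk ih
      exact (continuous_of_discreteTopology (f := fun p : Bool × List Bool => p.1 :: p.2)).comp this
  exact (isClopen_discrete {σ}).preimage (h σ.length)

lemma measurableSet_cyl (σ : List Bool) : MeasurableSet (cyl σ) :=
  (isClopen_cyl σ).isOpen.measurableSet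

lemma measurable_pathAt (R : Cantor) : Measurable (pathAt R) := by
  have key : ∀ n, (∀ σ, MeasurableSet {u | wordAt R u n = σ}) →
      MeasurableSet {u | pathAt R u n = true} := by
    intro n hn
    have : {u | pathAt R u n = true} =
        ⋃ σ : List Bool, {u | wordAt R u n = σ} ∩ Set.Ici (leftEnd R σ + mass R (false :: σ)) := by
      ext u
      simp [pathAt]
    rw [this]
    exact MeasurableSet.iUnion fun σ => (hn σ).inter measurableSet_Ici
  have hw : ∀ n σ, MeasurableSet {u | wordAt R u n = σ} := by
    intro n
    induction n with
    | zero => intro σ; simp [wordAt]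
    | succ n ih =>
      intro σ
      cases σ with
      | nil => simp [wordAt]
      | cons b σ =>
        have : {u | wordAt R u (n + 1) = b :: σ} =
            {u | pathAt R u n = b} ∩ {u | wordAt R u n = σ} := by
          ext u
          simp [wordAt, pathAt]
        rw [this]
        refine MeasurableSet.inter ?_ (ih σ)
        cases b
        · have h2 := (key n ih).compl
          convert h2 using 1
          ext u
          simp
        · exact key n ih
  refine measurable_pi_iff.2 fun n => measurable_to_bool ?_
  exact key n (hw n)

/-- The measure represented by `R`: the distribution of `pathAt R u` for `u` uniform in `[0,1)`. -/
noncomputable def rho (R : Cantor) : ProbabilityMeasure Cantor :=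
  ⟨(volume.restrict (Set.Ico (0 : ℝ) 1)).map (pathAt R), by
    have : IsProbabilityMeasure (volume.restrict (Set.Ico (0 : ℝ) 1)) := ⟨by simp⟩
    exact Measure.isProbabilityMeasure_map (measurable_pathAt R).aemeasurable⟩

/-- The defining property of `rho R`. -/
theorem rho_cyl (R : Cantor) (σ : List Bool) :
    (rho R : Measure Cantor) (cyl σ) = ENNReal.ofReal (mass R σ) := by
  have hI : Set.Ico (leftEnd R σ) (leftEnd R σ + mass R σ) ⊆ Set.Ico (0 : ℝ) 1 := by
    induction σ with
    | nil => simp [leftEnd, mass]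
    | cons b σ ih =>
      refine subset_trans ?_ ih
      have h0 := mass_nonneg R (false :: σ)
      have h1 := mass_nonneg R (true :: σ)
      have h2 := mass_add R σ
      cases b <;> simp only [leftEnd] <;> apply Set.Ico_subset_Ico <;> linarith
  change ((volume.restrict (Set.Ico (0 : ℝ) 1)).map (pathAt R)) (cyl σ) = _
  rw [Measure.map_apply (measurable_pathAt R) (measurableSet_cyl σ),
    Measure.restrict_apply (measurable_pathAt R (measurableSet_cyl σ))]
  have : pathAt R ⁻¹' cyl σ ∩ Set.Ico (0 : ℝ) 1 =
      Set.Ico (leftEnd R σ) (leftEnd R σ + mass R σ) := by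
    ext u
    constructor
    · rintro ⟨h, hu⟩
      exact (pathAt_mem_cyl R hu σ).1 h
    · intro h
      exact ⟨(pathAt_mem_cyl R (hI h) σ).2 h, hI h⟩
  rw [this, Real.volume_Ico]
  simp

lemma cyl_cons (b : Bool) (σ : List Bool) : cyl (b :: σ) = cyl σ ∩ {X | X σ.length = b} := by
  ext X
  simp [cyl, PiNat.res_succ, and_comm]

lemma cyl_res (X : Cantor) (n : ℕ) : cyl (PiNat.res X n) = PiNat.cylinder X n := by
  rw [PiNat.cylinder_eq_res]
  simp [cyl]

lemma cyl_eq_cylinder {X : Cantor} {σ : List Bool} (h : X ∈ cyl σ) :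
    cyl σ = PiNat.cylinder X σ.length := by
  rw [← cyl_res]
  exact congrArg cyl h.symm

lemma isPiSystem_cyl : IsPiSystem (Set.range cyl) := by
  rintro _ ⟨σ, rfl⟩ _ ⟨τ, rfl⟩ ⟨X, h1, h2⟩
  rcases le_total σ.length τ.length with h | h
  · refine ⟨τ, (Set.inter_eq_right.2 ?_).symm⟩
    rw [cyl_eq_cylinder h1, cyl_eq_cylinder h2]
    exact PiNat.cylinder_anti X h
  · refine ⟨σ, (Set.inter_eq_left.2 ?_).symm⟩
    rw [cyl_eq_cylinder h1, cyl_eq_cylinder h2]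
    exact PiNat.cylinder_anti X h

lemma exists_cyl_subset {U : Set Cantor} (hU : IsOpen U) {X : Cantor} (hX : X ∈ U) :
    ∃ s ∈ Set.range cyl, s ∈ nhds X ∧ s ⊆ U := by
  obtain ⟨n, hn⟩ : ∃ n, PiNat.cylinder X n ⊆ U := by
    have hb := PiNat.isTopologicalBasis_cylinders (fun _ : ℕ => Bool)
    obtain ⟨s, ⟨Y, n, rfl⟩, hXs, hs⟩ := hb.exists_subset_of_mem_open hX hU
    exact ⟨n, (PiNat.mem_cylinder_iff_eq.1 hXs).symm ▸ hs⟩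
  refine ⟨_, ⟨PiNat.res X n, rfl⟩, (isClopen_cyl _).isOpen.mem_nhds ?_, ?_⟩
  · simp [cyl]
  · rwa [cyl_res]

/-- The map `rho` is continuous for the weak-* topology. -/
theorem continuous_rho : Continuous rho := by
  have hc : ∀ σ, Continuous fun R : Cantor => column R σ := by
    intro σ
    have hd : ∀ g : ℕ → ℕ, Continuous fun R : Cantor =>
        Real.ofDigits (fun k => if R (g k) then (1 : Fin 2) else 0) := fun g =>
      Real.continuous_ofDigits.comp (continuous_pi fun k =>
        (continuous_of_discreteTopology (f := fun b : Bool => if b then (1 : Fin 2) else 0)).comp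
          (continuous_apply (g k)))
    exact ((hd fun k => Nat.pair (Encodable.encode σ) (2 * k)).add
      (hd fun k => Nat.pair (Encodable.encode σ) (2 * k + 1))).div_const 2
  have hm : ∀ σ, Continuous fun R : Cantor => mass R σ := by
    intro σ
    induction σ with
    | nil => exact continuous_const
    | cons b σ ih =>
      cases b
      · exact (hc σ).min ih
      · exact ih.sub ((hc σ).min ih)
  refine continuous_iff_continuousAt.2 fun R => ?_
  refine isPiSystem_cyl.tendsto_probabilityMeasure_of_tendsto_of_mem
    (by rintro _ ⟨σ, rfl⟩; exact measurableSet_cyl σ)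
    (fun U hU X hX => exists_cyl_subset hU hX) ?_
  rintro _ ⟨σ, rfl⟩
  have h : ∀ S, rho S (cyl σ) = (mass S σ).toNNReal := fun S => by
    rw [← ENNReal.coe_inj, ProbabilityMeasure.ennreal_coeFn_eq_coeFn_toMeasure, rho_cyl]
    rfl
  simp only [h]
  exact (continuous_real_toNNReal.comp (hm σ)).continuousAt

/-- Every probability measure on Cantor space has a representation. -/
theorem rho_surjective : Function.Surjective rho := by
  intro μ
  have hname : ∀ x ∈ Set.Icc (0 : ℝ) 1, ∃ b : ℕ → Bool, nameVal b = x := by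
    intro x hx
    obtain ⟨d, -, hd⟩ := Real.ofDigits_SurjOn (b := 2) (by norm_num) hx
    refine ⟨fun k => decide (d (k / 2) = 1), ?_⟩
    have h1 : (fun k => if decide (d (2 * k / 2) = 1) then (1 : Fin 2) else 0) = d := by
      funext k
      have : 2 * k / 2 = k := by omega
      rw [this]
      generalize d k = e
      revert e
      decide
    have h2 : (fun k => if decide (d ((2 * k + 1) / 2) = 1) then (1 : Fin 2) else 0) = d := by
      funext k
      have : (2 * k + 1) / 2 = k := by omega
      rw [this]
      generalize d k = e
      revert e
      decide
    unfold nameVal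
    rw [h1, h2, hd]
    ring
  choose! f hf using hname
  let val : List Bool → ℝ := fun σ => (μ : Measure Cantor).real (cyl (false :: σ))
  have hval : ∀ σ, val σ ∈ Set.Icc (0 : ℝ) 1 := fun σ => ⟨measureReal_nonneg, measureReal_le_one⟩
  let R : Cantor := fun n =>
    match (Encodable.decode (Nat.unpair n).1 : Option (List Bool)) with
    | some σ => f (val σ) (Nat.unpair n).2
    | none => false
  have hcol : ∀ σ, column R σ = val σ := by
    intro σ
    have : (fun k => R (Nat.pair (Encodable.encode σ) k)) = f (val σ) := by
      funext k
      simp [R]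
    rw [column, this, hf _ (hval σ)]
  have hmass : ∀ σ, mass R σ = (μ : Measure Cantor).real (cyl σ) := by
    intro σ
    induction σ with
    | nil =>
      have : cyl [] = Set.univ := by ext X; simp [cyl]
      simp [mass, this]
    | cons b σ ih =>
      have hle : val σ ≤ (μ : Measure Cantor).real (cyl σ) := by
        apply measureReal_mono _ (measure_ne_top _ _)
        rw [cyl_cons]
        exact Set.inter_subset_left
      have hadd : (μ : Measure Cantor).real (cyl σ) =
          val σ + (μ : Measure Cantor).real (cyl (true :: σ)) := by
        have hu : cyl σ = cyl (false :: σ) ∪ cyl (true :: σ) := by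
          rw [cyl_cons, cyl_cons, ← Set.inter_union_distrib_left]
          ext X
          cases h : X σ.length <;> simp [h]
        conv_lhs => rw [hu]
        refine measureReal_union ?_ (measurableSet_cyl _) (measure_ne_top _ _) (measure_ne_top _ _)
        rw [Set.disjoint_left, cyl_cons, cyl_cons]
        rintro X ⟨-, h1⟩ ⟨-, h2⟩
        simp only [Set.mem_ofPred_eq] at h1 h2
        simp [h1] at h2
      cases b
      · simp only [mass, hcol, ih]
        exact min_eq_left hle
      · simp only [mass, hcol, ih]
        rw [min_eq_left hle]
        linarith
  refine ⟨R, ?_⟩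
  apply Subtype.ext
  have hfin : IsProbabilityMeasure (rho R).1 := (rho R).2
  have hfin' : IsProbabilityMeasure μ.1 := μ.2
  refine MeasureTheory.ext_of_generate_finite (Set.range cyl) ?_ isPiSystem_cyl ?_ (by simp)
  · apply le_antisymm
    · have hle : (borel Cantor) ≤ MeasurableSpace.generateFrom (Set.range cyl) := by
        refine MeasurableSpace.generateFrom_le fun U hU => ?_
        have : U = ⋃ σ ∈ {σ | cyl σ ⊆ U}, cyl σ := by
          ext X
          simp only [Set.mem_iUnion]
          constructor
          · intro hX
            obtain ⟨_, ⟨σ, rfl⟩, h1, h2⟩ := exists_cyl_subset hU hX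
            exact ⟨σ, h2, mem_of_mem_nhds h1⟩
          · rintro ⟨σ, h2, h1⟩
            exact h2 h1
        rw [this]
        exact MeasurableSet.biUnion (Set.to_countable _) fun σ _ =>
          MeasurableSpace.measurableSet_generateFrom ⟨σ, rfl⟩
      rw [BorelSpace.measurable_eq (α := Cantor)]
      exact hle
    · apply MeasurableSpace.generateFrom_le
      rintro _ ⟨σ, rfl⟩
      exact measurableSet_cyl σ
  · rintro _ ⟨σ, rfl⟩
    change (rho R : Measure Cantor) (cyl σ) = (μ : Measure Cantor) (cyl σ)
    rw [rho_cyl, hmass, ofReal_measureReal]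

/-! ### Randomness -/

/-- `(V n)` is an `(R, A)`-test, where `R` is a representation of the measure `rho R`. -/
def IsTest (R A : Cantor) (V : ℕ → Set Cantor) : Prop :=
  UniformlySigmaOne (join R A) V ∧ ∀ n, (rho R : Measure Cantor) (V n) ≤ (2⁻¹ : ENNReal) ^ n

/-- `X` is `(R, A)`-random: it passes all `(R, A)`-tests. -/
def IsRandom (R A X : Cantor) : Prop :=
  ∀ V : ℕ → Set Cantor, IsTest R A V → X ∉ ⋂ n, V n

/-- `MLR_μ(A)`, the set of all reals that are `μ`-random relative to `A`, i.e. `(R, A)`-random for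
some representation `R` of `μ`. -/
def MLR (μ : ProbabilityMeasure Cantor) (A : Cantor) : Set Cantor :=
  {X | ∃ R, rho R = μ ∧ IsRandom R A X}

/-- `A` and `B` are relatively random with respect to `μ`. -/
def RelativelyRandom (μ : ProbabilityMeasure Cantor) (A B : Cantor) : Prop :=
  A ∈ MLR μ B ∧ B ∈ MLR μ A

/-- `(V n)` is an `(R, ∅)`-test on the product space with respect to the measure `μ × μ`, where `R`
is a representation of `μ = rho R`. -/
def IsProdTest (R : Cantor) (V : ℕ → Set (Cantor × Cantor)) : Prop :=
  UniformlySigmaOneProd (join R emptyReal) V ∧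
    ∀ n, ((rho R : Measure Cantor).prod (rho R : Measure Cantor)) (V n) ≤ (2⁻¹ : ENNReal) ^ n

/-- `MLR_{μ × μ}`, the set of all pairs that pass all `(R, ∅)`-tests on the product space, with
respect to `μ × μ`, for some representation `R` of `μ`. A representation of `μ` computes one of
`μ × μ`, and conversely, so it makes no difference which of the two the tests have access to. -/
def MLRProd (μ : ProbabilityMeasure Cantor) : Set (Cantor × Cantor) :=
  {p | ∃ R, rho R = μ ∧ ∀ V : ℕ → Set (Cantor × Cantor), IsProdTest R V → p ∉ ⋂ n, V n}

end CantorRandom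

/-! This is van Lambalgen's theorem for a measure that need not be computable. The extra difficulty
is that the two halves of relative randomness may be witnessed by different representations of `μ`.

From the product to the components, a single representation `R` serves throughout. Suppose an `(R,
B)`-test captures `A`. Replace `B` by a variable `Y` in its enumeration, and stop enumerating the
`n`-th section over `Y` before its measure reaches `2⁻ⁿ`. By Fubini this is a product test; over `Y
= B` nothing has been lost, so it captures `(A, B)` (`isRandom_of_forall_isProdTest`). The other
component follows by exchanging coordinates.

Conversely, let `R` witness the randomness of `A` and `S` that of `B`. The key is a product test
that depends on the measure alone (`exists_extensional_test`). There is a universal test `U^R` on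
the product, uniform in the representation (`exists_universal_test`), and its `n`-th set is replaced
by the intersection of the `n`-th sets of `U^{R'}` over all representations `R'` of the measure. The
representations of `rho S` form a `Π⁰₁(S)` class in a compact space, so this intersection is again
`Σ⁰₁(S)`: a rectangle is enumerated once, at some length `N`, every word is either seen not to begin
a representation of `rho S` or has already enumerated a covering rectangle. The intersection is
contained in the `n`-th set of `U^S`, hence small, and a pair outside `MLRProd` lies in all these
sets.

With this test the classical argument goes through. If `(A, B)` is captured, the points whose
section at level `2n` has measure above `2⁻ⁿ` form a set of measure at most `2⁻ⁿ` by Markov's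
inequality. These sets are enumerable in `R`, so the randomness of `A` makes the sections over `A`
small from some level on. They are then a test enumerable in `S ⊕ A`, because `R` and `S` yield the
same sets, and this test captures `B`.

Everything rests on enumerations that are uniform in the oracle (`CE`), since the oracle is a
variable both in the Fubini step and in the compactness argument. -/

namespace CantorRandom

open MeasureTheory

/-! ### Primitive recursive list functions -/

section Lists

variable {α β : Type*} [Primcodable α] [Primcodable β]

lemma primrec_list_any {f : α → List β} {g : α → β → Bool} (hf : Primrec f) (hg : Primrec₂ g) :
    Primrec fun a => (f a).any (g a) :=
  (Primrec.list_foldr hf (Primrec.const false)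
    (h := fun a p => g a p.1 || p.2)
    (Primrec.or.comp (hg.comp Primrec.fst (Primrec.fst.comp Primrec.snd))
      (Primrec.snd.comp Primrec.snd)).to₂).of_eq fun a => by
    induction f a with
    | nil => rfl
    | cons b l ih => simp only [List.foldr_cons, List.any_cons, ih]

lemma primrec_list_all {f : α → List β} {g : α → β → Bool} (hf : Primrec f) (hg : Primrec₂ g) :
    Primrec fun a => (f a).all (g a) :=
  (Primrec.list_foldr hf (Primrec.const true)
    (h := fun a p => g a p.1 && p.2)
    (Primrec.and.comp (hg.comp Primrec.fst (Primrec.fst.comp Primrec.snd))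
      (Primrec.snd.comp Primrec.snd)).to₂).of_eq fun a => by
    induction f a with
    | nil => rfl
    | cons b l ih => simp only [List.foldr_cons, List.all_cons, ih]

lemma primrec_list_filter {f : α → List β} {g : α → β → Bool} (hf : Primrec f) (hg : Primrec₂ g) :
    Primrec fun a => (f a).filter (g a) :=
  (Primrec.list_foldr hf (Primrec.const [])
    (h := fun a p => bif g a p.1 then p.1 :: p.2 else p.2)
    (Primrec.cond (hg.comp Primrec.fst (Primrec.fst.comp Primrec.snd))
      (Primrec.list_cons.comp (Primrec.fst.comp Primrec.snd) (Primrec.snd.comp Primrec.snd))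
      (Primrec.snd.comp Primrec.snd)).to₂).of_eq fun a => by
    induction f a with
    | nil => rfl
    | cons b l ih => cases h : g a b <;> simp [h, ih]

lemma primrec_list_sum : Primrec (List.sum : List ℕ → ℕ) :=
  (Primrec.list_foldr Primrec.id (Primrec.const 0)
    (h := fun _ p => p.1 + p.2)
    (Primrec.nat_add.comp (Primrec.fst.comp Primrec.snd) (Primrec.snd.comp Primrec.snd)).to₂).of_eq
    fun l => by
      induction l with
      | nil => rfl
      | cons b l ih => simpa using ih

lemma primrec_decide_eq {f g : α → β} [DecidableEq β] (hf : Primrec f) (hg : Primrec g) :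
    Primrec fun a => decide (f a = g a) :=
  (Primrec.eq.comp hf hg).decide

lemma primrec_decide_le {f g : α → ℕ} (hf : Primrec f) (hg : Primrec g) :
    Primrec fun a => decide (f a ≤ g a) :=
  (Primrec.nat_le.comp hf hg).decide

lemma primrec_decide_lt {f g : α → ℕ} (hf : Primrec f) (hg : Primrec g) :
    Primrec fun a => decide (f a < g a) :=
  (Primrec.nat_lt.comp hf hg).decide

/-- All elements of a type with codes less than `n`. -/
def below (β : Type*) [Primcodable β] (n : ℕ) : List β :=
  (List.range n).filterMap Encodable.decode

lemma primrec_below : Primrec (below β) :=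
  Primrec.listFilterMap Primrec.list_range (Primrec.decode.comp Primrec.snd).to₂

lemma mem_below {n : ℕ} {b : β} (h : Encodable.encode b < n) : b ∈ below β n :=
  List.mem_filterMap.2 ⟨_, List.mem_range.2 h, Encodable.encodek b⟩

lemma below_mono {n m : ℕ} (h : n ≤ m) {b : β} (hb : b ∈ below β n) : b ∈ below β m := by
  obtain ⟨i, hi, hb⟩ := List.mem_filterMap.1 hb
  exact List.mem_filterMap.2 ⟨i, List.mem_range.2 ((List.mem_range.1 hi).trans_le h), hb⟩

end Lists

/-! ### Predicates enumerable in an oracle, uniformly in the oracle -/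

lemma res_mono_of_cons {α : Type*} {q : List Bool × α → Bool}
    (hq : ∀ b τ a, q (τ, a) = true → q (b :: τ, a) = true) {Z : Cantor} {a : α} {m n : ℕ}
    (hmn : m ≤ n) (h : q (PiNat.res Z m, a) = true) : q (PiNat.res Z n, a) = true := by
  induction n, hmn using Nat.le_induction with
  | base => exact h
  | succ n _ ih => exact hq _ _ _ ih

section CE

variable {α β ι : Type*} [Primcodable α] [Primcodable β] [Primcodable ι]

/-- `P Z` is enumerable in `Z`, uniformly in `Z`: a primitive recursive test, applied to the initial
segments of `Z`, confirms `P Z a`; once confirmed, it stays so for longer initial segments. -/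
def CE (P : Cantor → α → Prop) : Prop :=
  ∃ q : List Bool × α → Bool, Primrec q ∧ (∀ b τ a, q (τ, a) = true → q (b :: τ, a) = true) ∧
    ∀ Z a, P Z a ↔ ∃ n, q (PiNat.res Z n, a) = true

lemma CE.of_eq {P Q : Cantor → α → Prop} (h : CE P) (H : ∀ Z a, P Z a ↔ Q Z a) : CE Q := by
  obtain ⟨q, h1, h2, h3⟩ := h
  exact ⟨q, h1, h2, fun Z a => (H Z a).symm.trans (h3 Z a)⟩

/-- Monotonicity costs nothing: the latest bit of a word comes first, so the tails of a word are its
shorter initial segments, and the test can be rerun on all of them. -/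
lemma CE.of_primrec_res {q : List Bool × α → Bool} (hq : Primrec q) :
    CE fun Z a => ∃ n, q (PiNat.res Z n, a) = true := by
  let q' : List Bool × α → Bool := fun p =>
    List.rec (q ([], p.2)) (fun b l IH => q (b :: l, p.2) || IH) p.1
  have hcons : ∀ b τ a, q' (b :: τ, a) = (q (b :: τ, a) || q' (τ, a)) := fun _ _ _ => rfl
  refine ⟨q', ?_, ?_, ?_⟩
  · refine Primrec.list_rec (f := fun p : List Bool × α => p.1) (g := fun p => q ([], p.2))
      (h := fun p r => q (r.1 :: r.2.1, p.2) || r.2.2) Primrec.fst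
      (hq.comp ((Primrec.const []).pair Primrec.snd)) ?_
    refine (Primrec.or.comp (hq.comp (Primrec.pair (Primrec.list_cons.comp
      (Primrec.fst.comp Primrec.snd) ((Primrec.fst.comp Primrec.snd).comp Primrec.snd))
      (Primrec.snd.comp Primrec.fst)))
      ((Primrec.snd.comp Primrec.snd).comp Primrec.snd)).to₂
  · intro b τ a h
    simp [hcons, h]
  · intro Z a
    have key : ∀ n, q' (PiNat.res Z n, a) = true ↔ ∃ m ≤ n, q (PiNat.res Z m, a) = true := by
      intro n
      induction n with
      | zero => simp [q']
      | succ n ih =>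
        rw [PiNat.res_succ, hcons, Bool.or_eq_true, ih, ← PiNat.res_succ]
        constructor
        · rintro (h | ⟨m, h1, h2⟩)
          · exact ⟨_, le_rfl, h⟩
          · exact ⟨m, by omega, h2⟩
        · rintro ⟨m, h1, h2⟩
          rcases Nat.lt_or_eq_of_le h1 with h | rfl
          · exact Or.inr ⟨m, by omega, h2⟩
          · exact Or.inl h2
    constructor
    · rintro ⟨n, h⟩
      exact ⟨n, (key n).2 ⟨n, le_rfl, h⟩⟩
    · rintro ⟨n, h⟩
      obtain ⟨m, -, h⟩ := (key n).1 h
      exact ⟨m, h⟩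

lemma CE.of_primrec {g : α → Bool} (hg : Primrec g) : CE fun _ a => g a = true :=
  (CE.of_primrec_res (hg.comp Primrec.snd)).of_eq fun _ _ => by simp

lemma CE.comp {P : Cantor → α → Prop} (h : CE P) {f : β → α} (hf : Primrec f) :
    CE fun Z b => P Z (f b) := by
  obtain ⟨q, h1, h2, h3⟩ := h
  exact ⟨fun p => q (p.1, f p.2), h1.comp (Primrec.fst.pair (hf.comp Primrec.snd)),
    fun b τ a => h2 b τ _, fun Z a => h3 Z _⟩

lemma CE.and {P Q : Cantor → α → Prop} (hP : CE P) (hQ : CE Q) : CE fun Z a => P Z a ∧ Q Z a := by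
  obtain ⟨p, p1, p2, p3⟩ := hP
  obtain ⟨q, q1, q2, q3⟩ := hQ
  refine ⟨fun x => p x && q x, Primrec.and.comp p1 q1, ?_, ?_⟩
  · intro b τ a
    simp only [Bool.and_eq_true]
    exact And.imp (p2 _ _ _) (q2 _ _ _)
  · intro Z a
    simp only [Bool.and_eq_true, p3, q3]
    constructor
    · rintro ⟨⟨m, hm⟩, ⟨n, hn⟩⟩
      exact ⟨max m n, res_mono_of_cons p2 (le_max_left _ _) hm,
        res_mono_of_cons q2 (le_max_right _ _) hn⟩
    · rintro ⟨n, h1, h2⟩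
      exact ⟨⟨n, h1⟩, ⟨n, h2⟩⟩

lemma CE.or {P Q : Cantor → α → Prop} (hP : CE P) (hQ : CE Q) : CE fun Z a => P Z a ∨ Q Z a := by
  obtain ⟨p, p1, p2, p3⟩ := hP
  obtain ⟨q, q1, q2, q3⟩ := hQ
  refine ⟨fun x => p x || q x, Primrec.or.comp p1 q1, ?_, ?_⟩
  · intro b τ a
    simp only [Bool.or_eq_true]
    exact Or.imp (p2 _ _ _) (q2 _ _ _)
  · intro Z a
    simp only [Bool.or_eq_true, p3, q3, exists_or]

lemma CE.exists {P : Cantor → α × β → Prop} (hP : CE P) : CE fun Z a => ∃ b, P Z (a, b) := by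
  obtain ⟨q, q1, q2, q3⟩ := hP
  -- The length of the initial segment doubles as a stage: it also bounds the codes of the witnesses
  -- tried.
  refine ⟨fun x => (below β x.1.length).any fun b => q (x.1, (x.2, b)), ?_, ?_, ?_⟩
  · refine primrec_list_any (primrec_below.comp (Primrec.list_length.comp Primrec.fst)) ?_
    exact (q1.comp (Primrec.pair (Primrec.fst.comp Primrec.fst)
      ((Primrec.snd.comp Primrec.fst).pair Primrec.snd))).to₂
  · intro b τ a
    simp only [List.any_eq_true]
    rintro ⟨c, hc, h⟩
    exact ⟨c, below_mono (by simp) hc, q2 _ _ _ h⟩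
  · intro Z a
    simp only [List.any_eq_true, q3, PiNat.res_length]
    constructor
    · rintro ⟨b, n, h⟩
      refine ⟨max n (Encodable.encode b + 1), b, mem_below (by omega), ?_⟩
      exact res_mono_of_cons q2 (le_max_left _ _) h
    · rintro ⟨n, b, -, h⟩
      exact ⟨b, n, h⟩

lemma CE.forall_mem {P : Cantor → α × β → Prop} (hP : CE P) {l : α → List β} (hl : Primrec l) :
    CE fun Z a => ∀ b ∈ l a, P Z (a, b) := by
  obtain ⟨q, q1, q2, q3⟩ := hP
  refine ⟨fun x => (l x.2).all fun b => q (x.1, (x.2, b)), ?_, ?_, ?_⟩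
  · refine primrec_list_all (hl.comp Primrec.snd) ?_
    exact (q1.comp (Primrec.pair (Primrec.fst.comp Primrec.fst)
      ((Primrec.snd.comp Primrec.fst).pair Primrec.snd))).to₂
  · intro b τ a
    simp only [List.all_eq_true]
    exact fun h c hc => q2 _ _ _ (h c hc)
  · intro Z a
    simp only [List.all_eq_true, q3]
    generalize l a = L
    -- The list is finite, so by monotonicity the maximum of the individual stages works for all its
    -- elements.
    constructor
    · intro h
      induction L with
      | nil => exact ⟨0, by simp⟩
      | cons c L ih =>
        obtain ⟨n, hn⟩ := ih fun b hb => h b (List.mem_cons_of_mem _ hb)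
        obtain ⟨m, hm⟩ := h c List.mem_cons_self
        refine ⟨max m n, fun b hb => ?_⟩
        rcases List.mem_cons.1 hb with rfl | hb
        · exact res_mono_of_cons q2 (le_max_left _ _) hm
        · exact res_mono_of_cons q2 (le_max_right _ _) (hn b hb)
    · rintro ⟨n, h⟩ b hb
      exact ⟨n, h b hb⟩

lemma CE.res_eq {u : α → ℕ} {f : α → List Bool} (hu : Primrec u) (hf : Primrec f) :
    CE fun Z a => PiNat.res Z (u a) = f a := by
  refine (CE.of_primrec_res (q := fun x : List Bool × α =>
    decide (x.1.length = u x.2) && decide (x.1 = f x.2)) ?_).of_eq ?_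
  · exact Primrec.and.comp
      (primrec_decide_eq (Primrec.list_length.comp Primrec.fst) (hu.comp Primrec.snd))
      (primrec_decide_eq Primrec.fst (hf.comp Primrec.snd))
  · intro Z a
    simp only [Bool.and_eq_true, decide_eq_true_eq, PiNat.res_length]
    constructor
    · rintro ⟨n, rfl, h⟩
      exact h
    · intro h
      exact ⟨_, rfl, h⟩

/-- An initial segment of the oracle, of computable length, may be used as a parameter. -/
lemma CE.subst_res {P : Cantor → α × List Bool → Prop} (hP : CE P) {u : α → ℕ} (hu : Primrec u) :
    CE fun Z a => P Z (a, PiNat.res Z (u a)) := by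
  refine (((CE.res_eq (hu.comp Primrec.fst) Primrec.snd).and hP).exists).of_eq fun Z a => ?_
  constructor
  · rintro ⟨τ, hτ, h⟩
    exact hτ.symm ▸ h
  · intro h
    exact ⟨_, rfl, h⟩

/-- A primitive recursive enumeration of the elements, from the initial segments of the oracle. -/
lemma CE.exists_enum {P : Cantor → ι × α → Prop} (hP : CE P) :
    ∃ E : List Bool × ι → List α, Primrec E ∧
      (∀ Z i m n, m ≤ n → ∀ a ∈ E (PiNat.res Z m, i), a ∈ E (PiNat.res Z n, i)) ∧
      ∀ Z i a, P Z (i, a) ↔ ∃ n, a ∈ E (PiNat.res Z n, i) := by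
  obtain ⟨q, q1, q2, q3⟩ := hP
  refine ⟨fun x => (below α x.1.length).filter fun a => q (x.1, (x.2, a)), ?_, ?_, ?_⟩
  · refine primrec_list_filter (primrec_below.comp (Primrec.list_length.comp Primrec.fst)) ?_
    exact (q1.comp (Primrec.pair (Primrec.fst.comp Primrec.fst)
      ((Primrec.snd.comp Primrec.fst).pair Primrec.snd))).to₂
  · intro Z i m n hmn a
    simp only [List.mem_filter, PiNat.res_length]
    exact And.imp (below_mono hmn) (res_mono_of_cons q2 hmn)
  · intro Z i a
    simp only [List.mem_filter, q3, PiNat.res_length]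
    constructor
    · rintro ⟨n, h⟩
      exact ⟨max n (Encodable.encode a + 1), mem_below (by omega),
        res_mono_of_cons q2 (le_max_left _ _) h⟩
    · rintro ⟨n, -, h⟩
      exact ⟨n, h⟩

end CE

/-! ### Enumerability in an oracle and Turing functionals -/

lemma res_getElem? (Z : Cantor) {i n : ℕ} (h : i < n) :
    (PiNat.res Z n).reverse[i]? = some (Z i) := by
  induction n with
  | zero => omega
  | succ n ih =>
    rw [PiNat.res_succ, List.reverse_cons]
    rcases Nat.lt_or_eq_of_le (Nat.lt_succ_iff.1 h) with h | rfl
    · rw [List.getElem?_append_left (by simpa using h), ih h]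
    · rw [List.getElem?_append_right (by simp)]
      simp

lemma res_getElem?_eq_none (Z : Cantor) {i n : ℕ} (h : n ≤ i) :
    (PiNat.res Z n).reverse[i]? = none := by
  simpa using h

/-- A functional on initial segments of `Z` that approximates `f`. -/
structure Approximates (Z : Cantor) (F : List Bool × ℕ →. ℕ) (f : ℕ →. ℕ) : Prop where
  mono : ∀ {m n x y}, m ≤ n → y ∈ F (PiNat.res Z m, x) → y ∈ F (PiNat.res Z n, x)
  mem_iff : ∀ x y, y ∈ f x ↔ ∃ n, y ∈ F (PiNat.res Z n, x)

lemma Approximates.of_total {Z : Cantor} {f : ℕ →. ℕ} :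
    Approximates Z (fun p => f p.2) f :=
  ⟨fun _ h => h, fun _ _ => by simp⟩

/-- Continuity of Turing functionals: a function recursive in `Z` is computed by a partial recursive
functional from the initial segments of `Z`. -/
lemma exists_approximates {Z : Cantor} {f : ℕ →. ℕ} (hf : Nat.RecursiveIn {oracle Z} f) :
    ∃ F : List Bool × ℕ →. ℕ, Partrec F ∧ Approximates Z F f := by
  induction hf with
  | zero => exact ⟨_, (Computable.const 0).partrec,
    Approximates.of_total (f := fun _ => Part.some 0)⟩
  | succ =>
    exact ⟨_, (Computable.succ.comp Computable.snd).partrec,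
      Approximates.of_total (f := fun n => Part.some (Nat.succ n))⟩
  | left =>
    exact ⟨_, (Computable.fst.comp (Computable.unpair.comp Computable.snd)).partrec,
      Approximates.of_total (f := fun n => Part.some (Nat.unpair n).1)⟩
  | right =>
    exact ⟨_, (Computable.snd.comp (Computable.unpair.comp Computable.snd)).partrec,
      Approximates.of_total (f := fun n => Part.some (Nat.unpair n).2)⟩
  | oracle g hg =>
    obtain rfl := hg
    -- A query beyond the end of the word gets no answer instead of a default bit; this keeps the
    -- functional monotone.
    refine ⟨fun p => ((p.1.reverse[p.2]?.map Bool.toNat : Option ℕ) : Part ℕ), ?_, ?_, ?_⟩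
    · exact Computable.ofOption (Computable.option_map
        (Computable.list_getElem?.comp (Computable.list_reverse.comp Computable.fst) Computable.snd)
        ((Primrec.dom_bool Bool.toNat).to_comp.comp Computable.snd).to₂)
    · intro m n x y hmn h
      simp only [Part.mem_coe] at h ⊢
      rcases lt_or_ge x m with hx | hx
      · rw [res_getElem? Z hx] at h
        rwa [res_getElem? Z (hx.trans_le hmn)]
      · rw [res_getElem?_eq_none Z hx] at h
        simp at h
    · intro x y
      simp only [Part.mem_coe, oracle, Part.mem_some_iff]
      constructor
      · rintro rfl
        exact ⟨x + 1, by simp⟩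
      · rintro ⟨n, h⟩
        rcases lt_or_ge x n with hx | hx
        · rw [res_getElem? Z hx] at h
          simpa using h.symm
        · rw [res_getElem?_eq_none Z hx] at h
          simp at h
  | @pair f h _ _ ihf ihh =>
    obtain ⟨F, hF, mF, iF⟩ := ihf
    obtain ⟨H, hH, mH, iH⟩ := ihh
    refine ⟨fun p => (F p).bind fun a => (H p).map fun b => Nat.pair a b, ?_, ?_, ?_⟩
    · refine hF.bind (Partrec.map (hH.comp Computable.fst) ?_)
      exact (Primrec₂.natPair.to_comp.comp (Computable.snd.comp Computable.fst)
        Computable.snd).to₂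
    · intro m n x y hmn
      simp only [Part.mem_bind_iff, Part.mem_map_iff]
      rintro ⟨a, ha, b, hb, rfl⟩
      exact ⟨a, mF hmn ha, b, mH hmn hb, rfl⟩
    · intro x y
      simp only [Seq.seq, Part.map_eq_map, Part.mem_bind_iff, Part.mem_map_iff, iF, iH]
      constructor
      · rintro ⟨_, ⟨a, ⟨m, ha⟩, rfl⟩, b, ⟨n, hb⟩, rfl⟩
        exact ⟨max m n, a, mF (le_max_left _ _) ha, b, mH (le_max_right _ _) hb, rfl⟩
      · rintro ⟨n, a, ha, b, hb, rfl⟩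
        exact ⟨_, ⟨a, ⟨n, ha⟩, rfl⟩, b, ⟨n, hb⟩, rfl⟩
  | @comp f h _ _ ihf ihh =>
    obtain ⟨F, hF, mF, iF⟩ := ihf
    obtain ⟨H, hH, mH, iH⟩ := ihh
    refine ⟨fun p => (H p).bind fun a => F (p.1, a), ?_, ?_, ?_⟩
    · exact hH.bind (hF.comp ((Computable.fst.comp Computable.fst).pair Computable.snd)).to₂
    · intro m n x y hmn
      simp only [Part.mem_bind_iff]
      rintro ⟨a, ha, hy⟩
      exact ⟨a, mH hmn ha, mF hmn hy⟩
    · intro x y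
      refine Part.mem_bind_iff.trans ?_
      simp only [Part.mem_bind_iff]
      constructor
      · rintro ⟨a, ha, hy⟩
        obtain ⟨m, ha⟩ := (iH _ _).1 ha
        obtain ⟨n, hy⟩ := (iF _ _).1 hy
        exact ⟨max m n, a, mH (le_max_left _ _) ha, mF (le_max_right _ _) hy⟩
      · rintro ⟨n, a, ha, hy⟩
        exact ⟨a, (iH _ _).2 ⟨n, ha⟩, (iF _ _).2 ⟨n, hy⟩⟩
  | @prec f h _ _ ihf ihh =>
    obtain ⟨F, hF, mF, iF⟩ := ihf
    obtain ⟨H, hH, mH, iH⟩ := ihh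
    -- The whole recursion runs on one fixed word; values found at different stages are brought
    -- together by monotonicity.
    let G : List Bool × ℕ →. ℕ := fun p =>
      Nat.rec (F (p.1, (Nat.unpair p.2).1)) (fun y IH => IH.bind fun i =>
        H (p.1, Nat.pair (Nat.unpair p.2).1 (Nat.pair y i))) (Nat.unpair p.2).2
    have hG0 : ∀ τ a, G (τ, Nat.pair a 0) = F (τ, a) := fun τ a => by simp [G]
    have hG1 : ∀ τ a k, G (τ, Nat.pair a (k + 1)) = (G (τ, Nat.pair a k)).bind fun i =>
        H (τ, Nat.pair a (Nat.pair k i)) := fun τ a k => by simp [G]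
    have hu : Computable fun p : List Bool × ℕ => (Nat.unpair p.2).1 :=
      Computable.fst.comp (Computable.unpair.comp Computable.snd)
    have mG : ∀ a k {m n y}, m ≤ n → y ∈ G (PiNat.res Z m, Nat.pair a k) →
        y ∈ G (PiNat.res Z n, Nat.pair a k) := by
      intro a k m n y hmn
      induction k generalizing y with
      | zero =>
        rw [hG0, hG0]
        exact mF hmn
      | succ k ih =>
        rw [hG1, hG1]
        simp only [Part.mem_bind_iff]
        rintro ⟨i, hi, hy⟩
        exact ⟨i, ih hi, mH hmn hy⟩
    refine ⟨G, ?_, ?_, ?_⟩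
    · refine Partrec.nat_rec
        (h := fun (p : List Bool × ℕ) (r : ℕ × ℕ) =>
          H (p.1, Nat.pair (Nat.unpair p.2).1 (Nat.pair r.1 r.2)))
        (Computable.snd.comp (Computable.unpair.comp Computable.snd))
        (hF.comp (Computable.fst.pair hu)) ?_
      have hc : Computable fun y : (List Bool × ℕ) × (ℕ × ℕ) =>
          (y.1.1, Nat.pair (Nat.unpair y.1.2).1 (Nat.pair y.2.1 y.2.2)) :=
        (Computable.fst.comp Computable.fst).pair
          (Primrec₂.natPair.to_comp.comp (hu.comp Computable.fst)
            (Primrec₂.natPair.to_comp.comp (Computable.fst.comp Computable.snd)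
              (Computable.snd.comp Computable.snd)))
      exact (hH.comp hc).to₂
    · intro m n x y hmn
      rw [← Nat.pair_unpair x]
      exact mG _ _ hmn
    · intro x
      rw [← Nat.pair_unpair x]
      generalize (Nat.unpair x).1 = a
      generalize (Nat.unpair x).2 = k
      simp only [Nat.unpair_pair]
      induction k with
      | zero =>
        intro y
        simp only [hG0]
        exact iF a y
      | succ k ih =>
        intro y
        simp only [hG1, Part.bind_eq_bind, Part.mem_bind_iff, iH]
        constructor
        · rintro ⟨i, hi, ⟨n, hy⟩⟩
          obtain ⟨m, hi⟩ := (ih i).1 hi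
          exact ⟨max m n, i, mG _ _ (le_max_left _ _) hi, mH (le_max_right _ _) hy⟩
        · rintro ⟨n, i, hi, hy⟩
          exact ⟨i, (ih i).2 ⟨n, hi⟩, n, hy⟩
  | @rfind f _ ihf =>
    obtain ⟨F, hF, mF, iF⟩ := ihf
    refine ⟨fun p => Nat.rfind fun n => (F (p.1, Nat.pair p.2 n)).map fun m => decide (m = 0),
      ?_, ?_, ?_⟩
    · refine Partrec.rfind (Partrec.map (hF.comp ((Computable.fst.comp Computable.fst).pair
        (Primrec₂.natPair.to_comp.comp (Computable.snd.comp Computable.fst) Computable.snd))) ?_)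
      exact ((primrec_decide_eq Primrec.id (Primrec.const 0)).to_comp.comp Computable.snd).to₂
    · intro m n x y hmn h
      obtain ⟨h1, h2⟩ := Nat.mem_rfind.1 h
      refine Nat.mem_rfind.2 ⟨?_, fun {k} hk => ?_⟩
      · obtain ⟨a, ha, h1⟩ := (Part.mem_map_iff _).1 h1
        exact (Part.mem_map_iff _).2 ⟨a, mF hmn ha, h1⟩
      · obtain ⟨a, ha, h1⟩ := (Part.mem_map_iff _).1 (h2 hk)
        exact (Part.mem_map_iff _).2 ⟨a, mF hmn ha, h1⟩
    · intro x y
      have key : ∀ k (b : Bool), b ∈ (fun m => decide (m = 0)) <$> f (Nat.pair x k) ↔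
          ∃ n, b ∈ (F (PiNat.res Z n, Nat.pair x k)).map fun m => decide (m = 0) := by
        intro k b
        simp only [Part.map_eq_map, Part.mem_map_iff, iF]
        constructor
        · rintro ⟨a, ⟨n, ha⟩, h⟩
          exact ⟨n, a, ha, h⟩
        · rintro ⟨n, a, ha, h⟩
          exact ⟨a, ⟨n, ha⟩, h⟩
      have hm : ∀ k (b : Bool) {m n}, m ≤ n →
          b ∈ ((F (PiNat.res Z m, Nat.pair x k)).map fun m => decide (m = 0)) →
          b ∈ (F (PiNat.res Z n, Nat.pair x k)).map fun m => decide (m = 0) := by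
        intro k b m n hmn h
        obtain ⟨a, ha, h1⟩ := (Part.mem_map_iff _).1 h
        exact (Part.mem_map_iff _).2 ⟨a, mF hmn ha, h1⟩
      constructor
      · intro h
        obtain ⟨h1, h2⟩ := Nat.mem_rfind.1 h
        -- A successful search has inspected only finitely many earlier values, so a single stage
        -- confirms all of them.
        have : ∃ N, ∀ k < y, false ∈
            (F (PiNat.res Z N, Nat.pair x k)).map fun m => decide (m = 0) := by
          have h3 : ∀ k < y, ∃ n, false ∈
              (F (PiNat.res Z n, Nat.pair x k)).map fun m => decide (m = 0) :=
            fun k hk => (key _ _).1 (h2 hk)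
          clear h h1 h2
          induction y with
          | zero => exact ⟨0, by simp⟩
          | succ y ih =>
            obtain ⟨N, hN⟩ := ih fun k hk => h3 k (by omega)
            obtain ⟨m, hb⟩ := h3 y (Nat.lt_succ_self y)
            refine ⟨max N m, fun k hk => ?_⟩
            rcases Nat.lt_or_eq_of_le (Nat.lt_succ_iff.1 hk) with hk | rfl
            · exact hm _ _ (le_max_left _ _) (hN k hk)
            · exact hm _ _ (le_max_right _ _) hb
        obtain ⟨N, hN⟩ := this
        obtain ⟨n, h1⟩ := (key _ _).1 h1
        exact ⟨max n N, Nat.mem_rfind.2 ⟨hm _ _ (le_max_left _ _) h1,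
          fun {k} hk => hm _ _ (le_max_right _ _) (hN k hk)⟩⟩
      · rintro ⟨n, h⟩
        obtain ⟨h1, h2⟩ := Nat.mem_rfind.1 h
        exact Nat.mem_rfind.2 ⟨(key _ _).2 ⟨n, h1⟩, fun {k} hk => (key _ _).2 ⟨n, h2 hk⟩⟩

/-! ### A universal enumeration, and the agreement of `CE` with `REIn` -/

section

variable {α : Type*} [Primcodable α]

/-- The uniformly enumerable predicate with index `e`. -/
def univ (α : Type*) [Primcodable α] (Z : Cantor) (x : ℕ × α) : Prop :=
  ∃ n k : ℕ, (Nat.Partrec.Code.evaln k (Denumerable.ofNat Nat.Partrec.Code x.1)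
    (Encodable.encode (PiNat.res Z n, x.2))).isSome = true

lemma ce_univ : CE (univ α) := by
  have hc : Primrec fun y : (((ℕ × α) × ℕ) × ℕ) × List Bool =>
      Denumerable.ofNat Nat.Partrec.Code y.1.1.1.1 := (Primrec.ofNat _).comp
    (Primrec.fst.comp (Primrec.fst.comp (Primrec.fst.comp Primrec.fst)))
  have hx : Primrec fun y : (((ℕ × α) × ℕ) × ℕ) × List Bool =>
      Encodable.encode (y.2, y.1.1.1.2) := Primrec.encode.comp (Primrec.snd.pair
    (Primrec.snd.comp (Primrec.fst.comp (Primrec.fst.comp Primrec.fst))))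
  have hk : Primrec fun y : (((ℕ × α) × ℕ) × ℕ) × List Bool => y.1.2 :=
    Primrec.snd.comp Primrec.fst
  have h : Primrec fun y : (((ℕ × α) × ℕ) × ℕ) × List Bool =>
      (Nat.Partrec.Code.evaln y.1.2 (Denumerable.ofNat Nat.Partrec.Code y.1.1.1.1)
        (Encodable.encode (y.2, y.1.1.1.2))).isSome :=
    Primrec.option_isSome.comp (Nat.Partrec.Code.primrec_evaln.comp ((hk.pair hc).pair hx))
  have hn : Primrec fun y : ((ℕ × α) × ℕ) × ℕ => y.1.2 := Primrec.snd.comp Primrec.fst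
  have h1 := ((CE.of_primrec h).subst_res hn).exists.exists
  exact h1

/-- The initial segment of the oracle is part of the input, so an ordinary code of `F` is an index
valid for all oracles at once. -/
lemma exists_univ_eq_of_partrec {F : List Bool × α →. ℕ} (hF : Partrec F) :
    ∃ e, ∀ Z a, univ α Z (e, a) ↔ ∃ n, (F (PiNat.res Z n, a)).Dom := by
  obtain ⟨c, hc⟩ := Nat.Partrec.Code.exists_code.1 hF
  refine ⟨Encodable.encode c, fun Z a => exists_congr fun n => ?_⟩
  have h : (F (PiNat.res Z n, a)).Dom ↔
      (c.eval (Encodable.encode (PiNat.res Z n, a))).Dom := by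
    rw [hc]
    simp
  rw [h, Part.dom_iff_mem]
  simp only [Denumerable.ofNat_encode, Nat.Partrec.Code.evaln_complete, Option.isSome_iff_exists]
  rw [exists_comm]
  rfl

lemma CE.exists_univ_eq {P : Cantor → α → Prop} (hP : CE P) :
    ∃ e, ∀ Z a, univ α Z (e, a) ↔ P Z a := by
  obtain ⟨q, q1, -, q3⟩ := hP
  obtain ⟨e, he⟩ := exists_univ_eq_of_partrec
    (F := fun x => ((if q x = true then some 0 else none : Option ℕ) : Part ℕ))
    (Computable.ofOption (Primrec.ite (Primrec.eq.comp q1 (Primrec.const true))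
      (Primrec.const (some 0)) (Primrec.const none)).to_comp)
  refine ⟨e, fun Z a => ?_⟩
  rw [he, q3]
  refine exists_congr fun n => ?_
  split_ifs with h <;> simp [h]

/-- An enumeration given for one oracle extends to all oracles by running its functional on other
initial segments. Nothing is known about the extension away from `Z`; in particular bounds on
measures may fail there, which is why the tests below have to be cut off. -/
lemma REIn.exists_ce {Z : Cantor} {p : α → Prop} (hp : REIn Z p) :
    ∃ P : Cantor → α → Prop, CE P ∧ ∀ a, P Z a ↔ p a := by
  obtain ⟨F, hF, hZ⟩ := exists_approximates hp
  obtain ⟨e, he⟩ := exists_univ_eq_of_partrec hF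
  refine ⟨fun Z a => univ ℕ Z (e, Encodable.encode a),
    ce_univ.comp ((Primrec.const e).pair Primrec.encode), fun a => ?_⟩
  refine (he Z _).trans ?_
  have := hZ.mem_iff (Encodable.encode a)
  simp only [Encodable.encodek, Part.coe_some, Part.bind_some, Part.mem_map_iff,
    Part.mem_assert_iff] at this
  simp only [Part.dom_iff_mem]
  constructor
  · rintro ⟨n, y, hy⟩
    obtain ⟨-, ⟨h, -⟩, -⟩ := (this y).2 ⟨n, hy⟩
    exact h
  · intro h
    obtain ⟨n, hn⟩ := (this (Encodable.encode ())).1 ⟨(), ⟨h, Part.mem_some _⟩, rfl⟩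
    exact ⟨n, _, hn⟩

lemma recursiveIn_res (Z : Cantor) :
    Nat.RecursiveIn {oracle Z} fun n => Part.some (Encodable.encode (PiNat.res Z n)) := by
  -- The input pairs the oracle's answer, 0 or 1, with a coded word. The default `[]` is never
  -- reached in the recursion, which meets only codes of words.
  have hc : Nat.RecursiveIn {oracle Z} fun x : ℕ =>
      (Part.some (Encodable.encode (decide ((Nat.unpair x).1 = 1) ::
        ((Encodable.decode (Nat.unpair x).2 : Option (List Bool)).getD []))) : Part ℕ) := by
    refine (Primrec.nat_iff.1 ?_).recursiveIn
    refine Primrec.encode.comp (Primrec.list_cons.comp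
      (primrec_decide_eq (Primrec.fst.comp Primrec.unpair) (Primrec.const 1))
      (Primrec.option_getD.comp (Primrec.decode.comp (Primrec.snd.comp Primrec.unpair))
        (Primrec.const [])))
  have hy : Nat.RecursiveIn {oracle Z} fun x : ℕ =>
      (Part.some (Nat.unpair (Nat.unpair x).2).1 : Part ℕ) :=
    (Primrec.nat_iff.1 (Primrec.fst.comp (Primrec.unpair.comp
      (Primrec.snd.comp Primrec.unpair)))).recursiveIn
  have hi : Nat.RecursiveIn {oracle Z} fun x : ℕ =>
      (Part.some (Nat.unpair (Nat.unpair x).2).2 : Part ℕ) :=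
    (Primrec.nat_iff.1 (Primrec.snd.comp (Primrec.unpair.comp
      (Primrec.snd.comp Primrec.unpair)))).recursiveIn
  have ho : Nat.RecursiveIn {oracle Z} fun x : ℕ =>
      (Part.some (Z (Nat.unpair (Nat.unpair x).2).1).toNat : Part ℕ) :=
    ((Nat.RecursiveIn.oracle (O := {oracle Z}) (oracle Z) rfl).comp hy).of_eq fun x =>
      Part.bind_some _ _
  have hstep : Nat.RecursiveIn {oracle Z} fun x : ℕ =>
      (Part.some (Encodable.encode (Z (Nat.unpair (Nat.unpair x).2).1 ::
        ((Encodable.decode (Nat.unpair (Nat.unpair x).2).2 : Option (List Bool)).getD []))) :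
          Part ℕ) := by
    refine (hc.comp (ho.pair hi)).of_eq fun x => ?_
    cases h : Z (Nat.unpair (Nat.unpair x).2).1 <;> simp [Seq.seq]
  have hpair : Nat.RecursiveIn {oracle Z} fun n : ℕ => (Part.some (Nat.pair 0 n) : Part ℕ) :=
    (Primrec.nat_iff.1 (Primrec₂.natPair.comp (Primrec.const 0) Primrec.id)).recursiveIn
  refine ((Nat.RecursiveIn.prec Nat.RecursiveIn.zero hstep).comp hpair).of_eq fun n => ?_
  refine (Part.bind_some _ _).trans ?_
  simp only [Nat.unpair_pair, Part.bind_eq_bind]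
  induction n with
  | zero => rfl
  | succ n ih =>
    simp only [ih, Part.bind_some, Encodable.encodek, Option.getD_some, PiNat.res_succ]

lemma CE.reIn {P : Cantor → α → Prop} (hP : CE P) (Z : Cantor) : REIn Z (P Z) := by
  obtain ⟨q, q1, -, q3⟩ := hP
  -- The value 0 means acceptance, since `Nat.rfind` looks for zeros; numbers that code nothing get
  -- 1, so that the search does not end on them.
  let g : ℕ → ℕ := fun x =>
    match (Encodable.decode x : Option (List Bool × α)) with
    | some y => if q y = true then 0 else 1
    | none => 1
  have hg : Nat.Primrec g := by
    refine Primrec.nat_iff.1 ((Primrec.option_casesOn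
      (f := fun _ => 1) (g := fun _ y => if q y = true then 0 else 1)
      (Primrec.decode (α := List Bool × α)) (Primrec.const 1) ?_).of_eq ?_)
    · exact (Primrec.ite (Primrec.eq.comp (q1.comp Primrec.snd) (Primrec.const true))
        (Primrec.const 0) (Primrec.const 1)).to₂
    · intro x
      simp only [g]
      cases (Encodable.decode x : Option (List Bool × α)) <;> rfl
  have hs : Nat.RecursiveIn {oracle Z} fun y : ℕ => (Part.some
      (g (Nat.pair (Encodable.encode (PiNat.res Z (Nat.unpair y).2)) (Nat.unpair y).1)) :
        Part ℕ) := by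
    refine ((hg.recursiveIn (O := {oracle Z})).comp
      (((recursiveIn_res Z).comp Nat.RecursiveIn.right).pair Nat.RecursiveIn.left)).of_eq
        fun y => ?_
    simp [Seq.seq]
  -- Composition with zero replaces the stage found by 0, the code of `()`.
  refine ((Nat.RecursiveIn.zero (O := {oracle Z})).comp hs.rfind).of_eq fun x => ?_
  refine Part.ext fun y => Part.mem_bind_iff.trans ?_
  have hdom : (∃ n, n ∈ Nat.rfind fun n => (fun m => decide (m = 0)) <$> (Part.some
      (g (Nat.pair (Encodable.encode (PiNat.res Z n)) x)) : Part ℕ)) ↔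
      ∃ n, g (Nat.pair (Encodable.encode (PiNat.res Z n)) x) = 0 := by
    refine Part.dom_iff_mem.symm.trans (Nat.rfind_dom'.trans (exists_congr fun n => ?_))
    simp only [Part.map_eq_map, Part.map_some, Part.mem_some_iff]
    exact ⟨fun h => by simpa using h.1.symm, fun h => ⟨by simpa using h, fun _ => trivial⟩⟩
  simp only [Nat.unpair_pair, exists_and_right, hdom]
  cases hx : (Encodable.decode x : Option α) with
  | none => simp [g, hx]
  | some a =>
    have h0 : y ∈ (0 : Part ℕ) ↔ y = 0 := Part.mem_some_iff
    have h1 : ∀ n, g (Nat.pair (Encodable.encode (PiNat.res Z n)) x) = 0 ↔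
        q (PiNat.res Z n, a) = true := by
      intro n
      simp [g, hx]
    simp only [h0, h1, ← q3, Part.coe_some, Part.bind_some, Part.mem_map_iff, Part.mem_assert_iff,
      Part.mem_some_iff, exists_prop]
    constructor
    · rintro ⟨h, rfl⟩
      exact ⟨(), ⟨h, trivial⟩, rfl⟩
    · rintro ⟨u, ⟨h, -⟩, rfl⟩
      exact ⟨h, rfl⟩

end

/-! ### Words as initial segments -/

/-- The bit at place `i` of a word, counted from the earliest one. -/
def bit (τ : List Bool) (i : ℕ) : Bool := τ.reverse.getD i false

lemma primrec_bit : Primrec₂ bit :=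
  ((Primrec.list_getD false).comp (Primrec.list_reverse.comp Primrec.fst) Primrec.snd).to₂

lemma bit_res (Z : Cantor) {i n : ℕ} (h : i < n) : bit (PiNat.res Z n) i = Z i := by
  simp [bit, List.getD_eq_getElem?_getD, res_getElem? Z h]

lemma res_eq_map (Z : Cantor) (n : ℕ) : PiNat.res Z n = (List.range n).reverse.map Z := by
  induction n with
  | zero => rfl
  | succ n ih => simp [List.range_succ, ih]

lemma res_suffix_res (Z : Cantor) {m n : ℕ} (h : m ≤ n) : PiNat.res Z m <:+ PiNat.res Z n := by
  induction n, h using Nat.le_induction with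
  | base => exact List.suffix_rfl
  | succ n _ ih => exact ih.trans (List.suffix_cons _ _)

lemma mem_cyl_res (Z : Cantor) (n : ℕ) : Z ∈ cyl (PiNat.res Z n) := by simp [cyl]

lemma mem_cyl_iff {Z : Cantor} {σ : List Bool} : Z ∈ cyl σ ↔ ∃ n, PiNat.res Z n = σ := by
  constructor
  · exact fun h => ⟨_, h⟩
  · rintro ⟨n, rfl⟩
    exact mem_cyl_res Z n

lemma cyl_subset_of_suffix {σ τ : List Bool} (h : σ <:+ τ) : cyl τ ⊆ cyl σ := by
  obtain ⟨ρ, rfl⟩ := h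
  induction ρ with
  | nil => exact subset_rfl
  | cons b ρ ih =>
    rw [List.cons_append, cyl_cons]
    exact Set.inter_subset_left.trans ih

lemma suffix_res_of_mem_cyl {Z : Cantor} {σ : List Bool} (h : Z ∈ cyl σ) {n : ℕ}
    (hn : σ.length ≤ n) : σ <:+ PiNat.res Z n := by
  have h' : PiNat.res Z σ.length = σ := h
  rw [← h']
  exact res_suffix_res Z hn

lemma cyl_nil : cyl [] = Set.univ := by
  ext
  simp [cyl]

/-- All words of length `n`. -/
def words : ℕ → List (List Bool)
  | 0 => [[]]
  | n + 1 => (words n).flatMap fun w => [false :: w, true :: w]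

lemma primrec_words : Primrec words := by
  refine (Primrec.nat_rec₁ (f := fun _ l => l.flatMap fun w => [false :: w, true :: w])
    [[]] ?_).of_eq ?_
  · have h : Primrec fun x : (ℕ × List (List Bool)) × List Bool => [false :: x.2, true :: x.2] :=
      Primrec.list_cons.comp (Primrec.list_cons.comp (Primrec.const false) Primrec.snd)
      (Primrec.list_cons.comp (Primrec.list_cons.comp (Primrec.const true) Primrec.snd)
        (Primrec.const []))
    exact (Primrec.list_flatMap Primrec.snd h.to₂).to₂
  · intro n
    induction n with
    | zero => rfl
    | succ n ih => simp only [words, ← ih]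

lemma mem_words {n : ℕ} {w : List Bool} : w ∈ words n ↔ w.length = n := by
  induction n generalizing w with
  | zero => simp [words]
  | succ n ih =>
    simp only [words, List.mem_flatMap, ih]
    constructor
    · rintro ⟨v, hv, h⟩
      rcases List.mem_cons.1 h with rfl | h
      · simp [hv]
      · rw [List.mem_singleton.1 h]
        simp [hv]
    · intro h
      cases w with
      | nil => simp at h
      | cons b v => exact ⟨v, by simpa using h, by cases b <;> simp⟩

lemma nodup_words (n : ℕ) : (words n).Nodup := by
  induction n with
  | zero => simp [words]
  | succ n ih =>
    rw [words, List.nodup_flatMap]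
    refine ⟨fun w _ => by simp, ih.imp fun {v w} hvw => ?_⟩
    simp only [Function.onFun, List.disjoint_left]
    intro u hu hu'
    simp only [List.mem_cons, List.not_mem_nil, or_false] at hu hu'
    rcases hu with rfl | rfl <;> rcases hu' with h | h <;> simp_all

/-! ### Changes of the oracle -/

section

variable {α : Type*} [Primcodable α]

/-- Here `Φ` is a Turing functional with a primitive recursive bound `v` on its use; an enumeration
from `Φ Z` can then be run from `Z`. -/
lemma CE.comp_oracle {P : Cantor → α → Prop} (hP : CE P) {Φ : Cantor → Cantor}
    {φ : List Bool → List Bool} {v : ℕ → ℕ} (hφ : Primrec φ) (hv : Primrec v)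
    (h : ∀ Z n, PiNat.res (Φ Z) n = φ (PiNat.res Z (v n))) : CE fun Z a => P (Φ Z) a := by
  obtain ⟨q, q1, -, q3⟩ := hP
  have hq : Primrec fun x : (α × ℕ) × List Bool => q (φ x.2, x.1.1) :=
    q1.comp ((hφ.comp Primrec.snd).pair (Primrec.fst.comp Primrec.fst))
  have hu : Primrec fun x : α × ℕ => v x.2 := hv.comp Primrec.snd
  refine (((CE.of_primrec hq).subst_res hu).exists).of_eq fun Z a => ?_
  simp only [q3, h]

/-- The real whose bits are the bits of `Z` at the places `2 i + c`. -/
def half (c : ℕ) (Z : Cantor) : Cantor := fun i => Z (2 * i + c)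

lemma half_zero_join (X Y : Cantor) : half 0 (join X Y) = X := by
  funext i
  simp [half, join]

lemma half_one_join (X Y : Cantor) : half 1 (join X Y) = Y := by
  funext i
  have : (2 * i + 1) / 2 = i := by omega
  simp [half, join, this]

lemma CE.comp_half {P : Cantor → α → Prop} (hP : CE P) (c : ℕ) : CE fun Z a => P (half c Z) a := by
  refine hP.comp_oracle (v := fun n => 2 * n + c)
    (φ := fun τ => (List.range ((τ.length - c) / 2)).reverse.map fun i => bit τ (2 * i + c)) ?_ ?_ ?_
  · refine Primrec.list_map (Primrec.list_reverse.comp (Primrec.list_range.comp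
      (Primrec.nat_div.comp (Primrec.nat_sub.comp Primrec.list_length (Primrec.const c))
        (Primrec.const 2)))) ?_
    exact (primrec_bit.comp Primrec.fst (Primrec.nat_add.comp (Primrec.nat_mul.comp
      (Primrec.const 2) Primrec.snd) (Primrec.const c))).to₂
  · exact Primrec.nat_add.comp (Primrec.nat_mul.comp (Primrec.const 2) Primrec.id)
      (Primrec.const c)
  · intro Z n
    rw [res_eq_map]
    have : ((PiNat.res Z (2 * n + c)).length - c) / 2 = n := by simp
    rw [this]
    refine List.map_congr_left fun i hi => ?_
    rw [List.mem_reverse, List.mem_range] at hi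
    rw [bit_res _ (by omega)]
    rfl

lemma CE.comp_join_empty {P : Cantor → α → Prop} (hP : CE P) :
    CE fun Z a => P (join Z emptyReal) a := by
  refine hP.comp_oracle (v := id)
    (φ := fun τ => (List.range τ.length).reverse.map fun i =>
      if i % 2 = 0 then bit τ (i / 2) else false) ?_ Primrec.id ?_
  · refine Primrec.list_map (Primrec.list_reverse.comp
      (Primrec.list_range.comp Primrec.list_length)) ?_
    exact (Primrec.ite (Primrec.eq.comp (Primrec.nat_mod.comp Primrec.snd (Primrec.const 2))
      (Primrec.const 0)) (primrec_bit.comp Primrec.fst (Primrec.nat_div.comp Primrec.snd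
        (Primrec.const 2))) (Primrec.const false)).to₂
  · intro Z n
    rw [res_eq_map, id, PiNat.res_length]
    refine List.map_congr_left fun i hi => ?_
    rw [List.mem_reverse, List.mem_range] at hi
    rw [bit_res _ (by omega)]
    rfl

/-- The initial segment of a join, from the initial segments of the two reals. -/
def joinWord (ρ τ : List Bool) : List Bool :=
  (List.range (2 * τ.length)).reverse.map fun i =>
    if i % 2 = 0 then bit ρ (i / 2) else bit τ (i / 2)

lemma primrec_joinWord : Primrec₂ joinWord := by
  have h : Primrec fun x : (List Bool × List Bool) × ℕ => x.2 / 2 :=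
    Primrec.nat_div.comp Primrec.snd (Primrec.const 2)
  have hb : Primrec fun x : (List Bool × List Bool) × ℕ =>
      if x.2 % 2 = 0 then bit x.1.1 (x.2 / 2) else bit x.1.2 (x.2 / 2) :=
    Primrec.ite (Primrec.eq.comp (Primrec.nat_mod.comp Primrec.snd (Primrec.const 2))
      (Primrec.const 0)) (primrec_bit.comp (Primrec.fst.comp Primrec.fst) h)
      (primrec_bit.comp (Primrec.snd.comp Primrec.fst) h)
  exact (Primrec.list_map (Primrec.list_reverse.comp (Primrec.list_range.comp
    (Primrec.nat_mul.comp (Primrec.const 2) (Primrec.list_length.comp Primrec.snd)))) hb.to₂).to₂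

lemma res_join (X Y : Cantor) (n : ℕ) :
    PiNat.res (join X Y) (2 * n) = joinWord (PiNat.res X n) (PiNat.res Y n) := by
  rw [res_eq_map, joinWord, PiNat.res_length]
  refine List.map_congr_left fun i hi => ?_
  rw [List.mem_reverse, List.mem_range] at hi
  rw [bit_res _ (by omega), bit_res _ (by omega)]
  rfl

end

/-! ### Approximation of the measure -/

/-- The first `k` digits of the number named by the column of `σ`, as a multiple of `2⁻¹ ^ (k+1)`. -/
def columnApprox (τ : List Bool) (k : ℕ) (σ : List Bool) : ℕ :=
  Nat.rec 0 (fun i c => 2 * c + ((bit τ (Nat.pair (Encodable.encode σ) (2 * i))).toNat +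
    (bit τ (Nat.pair (Encodable.encode σ) (2 * i + 1))).toNat)) k

/-- The approximation of the mass of `[σ]` that is computed from `k` digits of the columns. -/
def massApprox (τ : List Bool) (k : ℕ) : List Bool → ℕ
  | [] => 2 ^ (k + 1)
  | false :: σ => min (columnApprox τ k σ) (massApprox τ k σ)
  | true :: σ => massApprox τ k σ - min (columnApprox τ k σ) (massApprox τ k σ)

lemma primrec_two_pow : Primrec fun k : ℕ => 2 ^ (k + 1) :=
  (Primrec.nat_rec₁ (f := fun _ c => 2 * c) 2 (Primrec.nat_mul.comp (Primrec.const 2)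
    Primrec.snd).to₂).of_eq fun k => by
      induction k with
      | zero => rfl
      | succ k ih => simp only [ih]; ring

lemma primrec_columnApprox :
    Primrec fun x : (List Bool × ℕ) × List Bool => columnApprox x.1.1 x.1.2 x.2 := by
  have hi : Primrec fun y : ((List Bool × ℕ) × List Bool) × (ℕ × ℕ) => 2 * y.2.1 :=
    Primrec.nat_mul.comp (Primrec.const 2) (Primrec.fst.comp Primrec.snd)
  have hτ : Primrec fun y : ((List Bool × ℕ) × List Bool) × (ℕ × ℕ) => y.1.1.1 :=
    Primrec.fst.comp (Primrec.fst.comp Primrec.fst)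
  have hσ : Primrec fun y : ((List Bool × ℕ) × List Bool) × (ℕ × ℕ) => Encodable.encode y.1.2 :=
    Primrec.encode.comp (Primrec.snd.comp Primrec.fst)
  have hb : Primrec Bool.toNat := Primrec.dom_bool _
  have hstep : Primrec fun y : ((List Bool × ℕ) × List Bool) × (ℕ × ℕ) =>
      2 * y.2.2 + ((bit y.1.1.1 (Nat.pair (Encodable.encode y.1.2) (2 * y.2.1))).toNat +
        (bit y.1.1.1 (Nat.pair (Encodable.encode y.1.2) (2 * y.2.1 + 1))).toNat) :=
    Primrec.nat_add.comp
      (Primrec.nat_mul.comp (Primrec.const 2) (Primrec.snd.comp Primrec.snd))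
      (Primrec.nat_add.comp
        (hb.comp (primrec_bit.comp hτ (Primrec₂.natPair.comp hσ hi)))
        (hb.comp (primrec_bit.comp hτ (Primrec₂.natPair.comp hσ (Primrec.succ.comp hi)))))
  exact Primrec.nat_rec' (Primrec.snd.comp Primrec.fst) (Primrec.const 0) hstep.to₂

lemma primrec_massApprox :
    Primrec fun x : (List Bool × ℕ) × List Bool => massApprox x.1.1 x.1.2 x.2 := by
  have hm : Primrec fun y : ((List Bool × ℕ) × List Bool) × (Bool × List Bool × ℕ) =>
      min (columnApprox y.1.1.1 y.1.1.2 y.2.2.1) y.2.2.2 :=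
    Primrec.nat_min.comp (primrec_columnApprox.comp ((Primrec.fst.comp Primrec.fst).pair
      (Primrec.fst.comp (Primrec.snd.comp Primrec.snd))))
      (Primrec.snd.comp (Primrec.snd.comp Primrec.snd))
  have hstep : Primrec fun y : ((List Bool × ℕ) × List Bool) × (Bool × List Bool × ℕ) =>
      bif y.2.1 then y.2.2.2 - min (columnApprox y.1.1.1 y.1.1.2 y.2.2.1) y.2.2.2
      else min (columnApprox y.1.1.1 y.1.1.2 y.2.2.1) y.2.2.2 :=
    Primrec.cond (Primrec.fst.comp Primrec.snd)
      (Primrec.nat_sub.comp (Primrec.snd.comp (Primrec.snd.comp Primrec.snd)) hm) hm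
  refine (Primrec.list_rec (f := fun x : (List Bool × ℕ) × List Bool => x.2)
    (g := fun x => 2 ^ (x.1.2 + 1)) Primrec.snd
    (primrec_two_pow.comp (Primrec.snd.comp Primrec.fst)) hstep.to₂).of_eq ?_
  rintro ⟨⟨τ, k⟩, σ⟩
  induction σ with
  | nil => rfl
  | cons b σ ih =>
    simp only at ih
    cases b <;> simp only [ih, massApprox, cond_true, cond_false]

lemma massApprox_le (τ : List Bool) (k : ℕ) (σ : List Bool) : massApprox τ k σ ≤ 2 ^ (k + 1) := by
  induction σ with
  | nil => exact le_rfl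
  | cons b σ ih =>
    cases b
    · exact (min_le_right _ _).trans ih
    · exact (Nat.sub_le _ _).trans ih

lemma mass_le_one (R : Cantor) (σ : List Bool) : mass R σ ≤ 1 := by
  induction σ with
  | nil => exact le_rfl
  | cons b σ ih =>
    have h0 := mass_nonneg R (false :: σ)
    have h1 := mass_nonneg R (true :: σ)
    have h2 := mass_add R σ
    cases b <;> linarith

/-- A bound on the places of the oracle that are used for `massApprox`. -/
def use (k : ℕ) (σ : List Bool) : ℕ := Nat.pair (Encodable.encode σ) (2 * k) + 1

lemma primrec_use : Primrec₂ use :=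
  (Primrec.succ.comp (Primrec₂.natPair.comp (Primrec.encode.comp Primrec.snd)
    (Primrec.nat_mul.comp (Primrec.const 2) Primrec.fst))).to₂

/-- The mass of a word depends on the columns of all its proper initial segments, so the bound on
the use has to grow along them. -/
lemma use_cons_le (k : ℕ) (b : Bool) (σ : List Bool) : use k σ ≤ use k (b :: σ) := by
  have h : Encodable.encode σ < Encodable.encode (b :: σ) := by
    rw [Encodable.encode_list_cons]
    exact Nat.lt_succ_of_le (Nat.right_le_pair _ _)
  exact Nat.succ_le_succ (Nat.pair_lt_pair_left _ h).le

/-- After scaling by `2 ^ (k + 1)` the error is exactly the sum of the two expansions left over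
after `k` digits, each in `[0,1]`. -/
lemma columnApprox_error (R : Cantor) {n k : ℕ} {σ : List Bool} (h : use k σ ≤ n) :
    |2 ^ (k + 1) * column R σ - columnApprox (PiNat.res R n) k σ| ≤ 2 := by
  have hlt : ∀ i < 2 * k, bit (PiNat.res R n) (Nat.pair (Encodable.encode σ) i) =
      R (Nat.pair (Encodable.encode σ) i) := by
    intro i hi
    refine bit_res R (lt_of_lt_of_le ?_ h)
    exact Nat.lt_succ_of_lt (Nat.pair_lt_pair_right _ hi)
  unfold column nameVal columnApprox
  set d : ℕ → Fin 2 := fun i => if R (Nat.pair (Encodable.encode σ) (2 * i)) then 1 else 0 with hd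
  set e : ℕ → Fin 2 := fun i => if R (Nat.pair (Encodable.encode σ) (2 * i + 1)) then 1 else 0
    with he
  have key : ∀ j ≤ k, (((Nat.rec 0 (fun i c => 2 * c +
      ((bit (PiNat.res R n) (Nat.pair (Encodable.encode σ) (2 * i))).toNat +
        (bit (PiNat.res R n) (Nat.pair (Encodable.encode σ) (2 * i + 1))).toNat)) j : ℕ)) : ℝ) =
      2 ^ j * (∑ i ∈ Finset.range j, Real.ofDigitsTerm d i +
        ∑ i ∈ Finset.range j, Real.ofDigitsTerm e i) := by
    intro j hj
    induction j with
    | zero => simp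
    | succ j ih =>
      have hT : ∀ b : Bool, (((if b then 1 else 0 : Fin 2) : ℕ) : ℝ) = (b.toNat : ℝ) := by
        intro b
        cases b <;> simp
      have h1 : (2 : ℝ) ^ (j + 1) * ((2 : ℝ) ^ (j + 1))⁻¹ = 1 := mul_inv_cancel₀ (by positivity)
      simp only [Finset.sum_range_succ, Nat.cast_add, Nat.cast_mul, ih (by omega),
        hlt (2 * j) (by omega), hlt (2 * j + 1) (by omega), Real.ofDigitsTerm]
      simp only [hd, he, hT, Nat.cast_ofNat]
      linear_combination (-((R (Nat.pair (Encodable.encode σ) (2 * j))).toNat : ℝ)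
        - (R (Nat.pair (Encodable.encode σ) (2 * j + 1))).toNat) * h1
  rw [key k le_rfl, Real.ofDigits_eq_sum_add_ofDigits d k, Real.ofDigits_eq_sum_add_ofDigits e k]
  have h1 := Real.ofDigits_nonneg fun i => d (i + k)
  have h2 := Real.ofDigits_nonneg fun i => e (i + k)
  have h3 := Real.ofDigits_le_one fun i => d (i + k)
  have h4 := Real.ofDigits_le_one fun i => e (i + k)
  have h5 : (2 : ℝ) ^ k * ((2 : ℝ) ^ k)⁻¹ = 1 := mul_inv_cancel₀ (by positivity)
  rw [abs_le]
  generalize Real.ofDigits (fun i => d (i + k)) = u at *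
  generalize Real.ofDigits (fun i => e (i + k)) = v at *
  generalize ∑ i ∈ Finset.range k, Real.ofDigitsTerm d i = s
  generalize ∑ i ∈ Finset.range k, Real.ofDigitsTerm e i = t
  have : 2 ^ (k + 1) * ((s + ((2 : ℕ) ^ k : ℝ)⁻¹ * u + (t + ((2 : ℕ) ^ k : ℝ)⁻¹ * v)) / 2) -
      2 ^ k * (s + t) = u + v := by
    push_cast
    linear_combination (u + v) * h5
  rw [this]
  constructor <;> linarith

/-- Each bit adds at most 2 to the error. For a bit 0 the minimum does not increase the larger of
the two errors. For a bit 1 the new mass is the positive part of the old mass minus the column, and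
the errors add. -/
lemma massApprox_error (R : Cantor) {n k : ℕ} {σ : List Bool} (h : use k σ ≤ n) :
    |2 ^ (k + 1) * mass R σ - massApprox (PiNat.res R n) k σ| ≤ 2 * σ.length := by
  induction σ with
  | nil => simp [mass, massApprox]
  | cons b σ ih =>
    have h' := (use_cons_le k b σ).trans h
    have h1 := columnApprox_error R h'
    have h2 := ih h'
    have hmin : |min (2 ^ (k + 1) * column R σ) (2 ^ (k + 1) * mass R σ) -
        min (columnApprox (PiNat.res R n) k σ : ℝ) (massApprox (PiNat.res R n) k σ)| ≤ _ :=
      abs_min_sub_min_le_max _ _ _ _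
    rw [← mul_min_of_nonneg _ _ (by positivity)] at hmin
    rw [abs_le] at h1 h2
    simp only [List.length_cons, Nat.cast_add, Nat.cast_one]
    cases b
    · simp only [mass, massApprox, Nat.cast_min]
      refine hmin.trans (max_le ?_ ?_) <;> rw [abs_le] <;> constructor <;>
        linarith [Nat.cast_nonneg (α := ℝ) σ.length]
    · simp only [mass, massApprox, Nat.cast_sub (min_le_right _ _), Nat.cast_min, mul_sub,
        mul_min_of_nonneg _ _ (show (0 : ℝ) ≤ 2 ^ (k + 1) by positivity)]
      rw [abs_le]
      rcases min_cases (2 ^ (k + 1) * column R σ) (2 ^ (k + 1) * mass R σ) with ⟨e1, e2⟩ | ⟨e1, e2⟩ <;>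
      rcases min_cases (columnApprox (PiNat.res R n) k σ : ℝ) (massApprox (PiNat.res R n) k σ) with
        ⟨e3, e4⟩ | ⟨e3, e4⟩ <;> rw [e1, e3] <;> constructor <;> linarith

/-! ### Finite unions of rectangles -/

/-- The union of finitely many basic rectangles. -/
def boxes (L : List (List Bool × List Bool)) : Set (Cantor × Cantor) :=
  ⋃ p ∈ L, cyl p.1 ×ˢ cyl p.2

lemma mem_boxes {L : List (List Bool × List Bool)} {z : Cantor × Cantor} :
    z ∈ boxes L ↔ ∃ p ∈ L, z.1 ∈ cyl p.1 ∧ z.2 ∈ cyl p.2 := by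
  simp only [boxes, Set.mem_iUnion, Set.mem_prod, exists_prop]

/-- Whether the rectangle `[s] × [t]` is contained in one of the rectangles of the list. -/
def covered (L : List (List Bool × List Bool)) (s t : List Bool) : Bool :=
  L.any fun p => decide (s.drop (s.length - p.1.length) = p.1) &&
    decide (t.drop (t.length - p.2.length) = p.2)

lemma covered_iff {L : List (List Bool × List Bool)} {s t : List Bool} :
    covered L s t = true ↔ ∃ p ∈ L, p.1 <:+ s ∧ p.2 <:+ t := by
  simp only [covered, List.any_eq_true, Bool.and_eq_true, decide_eq_true_eq,
    List.suffix_iff_eq_drop]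
  simp only [eq_comm]

lemma primrec_covered : Primrec fun x : List (List Bool × List Bool) × (List Bool × List Bool) =>
    covered x.1 x.2.1 x.2.2 := by
  have h : ∀ {f g : (List (List Bool × List Bool) × (List Bool × List Bool)) ×
      (List Bool × List Bool) → List Bool}, Primrec f → Primrec g →
      Primrec fun y => decide ((f y).drop ((f y).length - (g y).length) = g y) := fun hf hg =>
    primrec_decide_eq (Primrec.list_drop.comp (Primrec.nat_sub.comp (Primrec.list_length.comp hf)
      (Primrec.list_length.comp hg)) hf) hg
  exact primrec_list_any Primrec.fst (Primrec.and.comp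
    (h (Primrec.fst.comp (Primrec.snd.comp Primrec.fst)) (Primrec.fst.comp Primrec.snd))
    (h (Primrec.snd.comp (Primrec.snd.comp Primrec.fst)) (Primrec.snd.comp Primrec.snd))).to₂

/-- A bound on the lengths of the words in the list. -/
def maxLen (L : List (List Bool × List Bool)) : ℕ :=
  L.foldr (fun p n => max (max p.1.length p.2.length) n) 0

lemma primrec_maxLen : Primrec maxLen := by
  refine Primrec.list_foldr (h := fun (_ : List (List Bool × List Bool))
    (y : (List Bool × List Bool) × ℕ) => max (max y.1.1.length y.1.2.length) y.2)
    Primrec.id (Primrec.const 0) ?_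
  exact (Primrec.nat_max.comp (Primrec.nat_max.comp
    (Primrec.list_length.comp (Primrec.fst.comp (Primrec.fst.comp Primrec.snd)))
    (Primrec.list_length.comp (Primrec.snd.comp (Primrec.fst.comp Primrec.snd))))
    (Primrec.snd.comp Primrec.snd)).to₂

lemma length_le_maxLen {L : List (List Bool × List Bool)} {p : List Bool × List Bool} (hp : p ∈ L) :
    p.1.length ≤ maxLen L ∧ p.2.length ≤ maxLen L := by
  induction L with
  | nil => simp at hp
  | cons q L ih =>
    simp only [maxLen, List.foldr_cons] at ih ⊢
    rcases List.mem_cons.1 hp with rfl | hp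
    · omega
    · have := ih hp
      omega

lemma mem_boxes_iff_covered {L : List (List Bool × List Bool)} {z : Cantor × Cantor} {m n : ℕ}
    (hm : maxLen L ≤ m) (hn : maxLen L ≤ n) :
    z ∈ boxes L ↔ covered L (PiNat.res z.1 m) (PiNat.res z.2 n) = true := by
  rw [mem_boxes, covered_iff]
  refine exists_congr fun p => and_congr_right fun hp => ?_
  have := length_le_maxLen hp
  exact ⟨fun h => ⟨suffix_res_of_mem_cyl h.1 (by omega), suffix_res_of_mem_cyl h.2 (by omega)⟩,
    fun h => ⟨cyl_subset_of_suffix h.1 (mem_cyl_res _ _),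
      cyl_subset_of_suffix h.2 (mem_cyl_res _ _)⟩⟩

instance (R : Cantor) : IsProbabilityMeasure (rho R : Measure Cantor) := (rho R).2

/-- The product of the measure represented by `R` with itself. -/
noncomputable abbrev rhoSq (R : Cantor) : Measure (Cantor × Cantor) :=
  (rho R : Measure Cantor).prod (rho R : Measure Cantor)

/-- The measure of a finite union of rectangles, as a sum over the rectangles of words of the
same length. -/
lemma rhoSq_boxes (R : Cantor) (L : List (List Bool × List Bool)) :
    (rhoSq R).real (boxes L) = ((words (maxLen L)).map fun s => ((words (maxLen L)).map fun t =>
      if covered L s t = true then mass R s * mass R t else 0).sum).sum := by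
  set N := maxLen L
  -- Cutting every rectangle into rectangles of words of the common length `N` makes the union
  -- disjoint.
  have hb : boxes L = ⋃ p ∈ ((words N).toFinset ×ˢ (words N).toFinset).filter
      (fun p => covered L p.1 p.2 = true), cyl p.1 ×ˢ cyl p.2 := by
    ext z
    rw [mem_boxes_iff_covered le_rfl le_rfl]
    simp only [Finset.mem_filter, Finset.mem_product, List.mem_toFinset, mem_words, Set.mem_iUnion,
      Set.mem_prod, exists_prop, Prod.exists]
    constructor
    · intro h
      exact ⟨_, _, ⟨⟨PiNat.res_length _ _, PiNat.res_length _ _⟩, h⟩, mem_cyl_res _ _,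
        mem_cyl_res _ _⟩
    · rintro ⟨s, t, ⟨⟨hs, ht⟩, h⟩, h1, h2⟩
      have e1 : PiNat.res z.1 N = s := by rw [← hs]; exact h1
      have e2 : PiNat.res z.2 N = t := by rw [← ht]; exact h2
      rwa [e1, e2]
  rw [hb, measureReal_biUnion_finset]
  · rw [Finset.sum_filter, Finset.sum_product, List.sum_toFinset _ (nodup_words N)]
    refine congrArg List.sum (List.map_congr_left fun s _ => ?_)
    rw [List.sum_toFinset _ (nodup_words N)]
    refine congrArg List.sum (List.map_congr_left fun t _ => ?_)
    have h : ∀ w, (rho R : Measure Cantor).real (cyl w) = mass R w := fun w => by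
      rw [measureReal_def, rho_cyl, ENNReal.toReal_ofReal (mass_nonneg R w)]
    rw [measureReal_prod_prod, h, h]
  · intro p hp q hq hpq
    simp only [Finset.coe_filter, Finset.mem_product, List.mem_toFinset, mem_words,
      Set.mem_ofPred_eq] at hp hq
    refine Set.disjoint_left.2 fun z h1 h2 => hpq ?_
    have e1 : PiNat.res z.1 N = p.1 := by rw [← hp.1.1]; exact h1.1
    have e2 : PiNat.res z.2 N = p.2 := by rw [← hp.1.2]; exact h1.2
    have e3 : PiNat.res z.1 N = q.1 := by rw [← hq.1.1]; exact h2.1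
    have e4 : PiNat.res z.2 N = q.2 := by rw [← hq.1.2]; exact h2.2
    exact Prod.ext (e1.symm.trans e3) (e2.symm.trans e4)
  · exact fun p _ => (measurableSet_cyl _).prod (measurableSet_cyl _)

/-- The approximation of the measure of `boxes L`, as a multiple of `(2⁻¹ ^ (k+1)) ^ 2`. -/
def boxesApprox (τ : List Bool) (k : ℕ) (L : List (List Bool × List Bool)) : ℕ :=
  ((words (maxLen L)).map fun s => ((words (maxLen L)).map fun t =>
    if covered L s t = true then massApprox τ k s * massApprox τ k t else 0).sum).sum

lemma primrec_boxesApprox : Primrec fun x : (List Bool × ℕ) × List (List Bool × List Bool) =>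
    boxesApprox x.1.1 x.1.2 x.2 := by
  have hw : Primrec fun L : List (List Bool × List Bool) => words (maxLen L) :=
    primrec_words.comp primrec_maxLen
  have h1 : Primrec fun y : (((List Bool × ℕ) × List (List Bool × List Bool)) × List Bool) ×
      List Bool => if covered y.1.1.2 y.1.2 y.2 = true then
        massApprox y.1.1.1.1 y.1.1.1.2 y.1.2 * massApprox y.1.1.1.1 y.1.1.1.2 y.2 else 0 := by
    have hk : Primrec fun y : (((List Bool × ℕ) × List (List Bool × List Bool)) × List Bool) ×
      List Bool => y.1.1.1 := Primrec.fst.comp (Primrec.fst.comp Primrec.fst)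
    have hs : Primrec fun y : (((List Bool × ℕ) × List (List Bool × List Bool)) × List Bool) ×
      List Bool => y.1.2 := Primrec.snd.comp Primrec.fst
    have hc : Primrec fun y : (((List Bool × ℕ) × List (List Bool × List Bool)) × List Bool) ×
        List Bool => covered y.1.1.2 y.1.2 y.2 := (primrec_covered.comp
      ((Primrec.snd.comp (Primrec.fst.comp Primrec.fst)).pair (hs.pair Primrec.snd)) :)
    have hm : Primrec fun y : (((List Bool × ℕ) × List (List Bool × List Bool)) × List Bool) ×
        List Bool => massApprox y.1.1.1.1 y.1.1.1.2 y.1.2 * massApprox y.1.1.1.1 y.1.1.1.2 y.2 :=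
      (Primrec.nat_mul.comp (primrec_massApprox.comp (hk.pair hs))
        (primrec_massApprox.comp (hk.pair Primrec.snd)) :)
    exact Primrec.ite (Primrec.eq.comp hc (Primrec.const true)) hm (Primrec.const 0)
  have h2 : Primrec fun y : ((List Bool × ℕ) × List (List Bool × List Bool)) × List Bool =>
      ((words (maxLen y.1.2)).map fun t => if covered y.1.2 y.2 t = true then
        massApprox y.1.1.1 y.1.1.2 y.2 * massApprox y.1.1.1 y.1.1.2 t else 0).sum :=
    primrec_list_sum.comp (Primrec.list_map (hw.comp (Primrec.snd.comp Primrec.fst)) h1.to₂)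
  exact primrec_list_sum.comp (Primrec.list_map (hw.comp Primrec.snd) h2.to₂)

/-- A bound on the places of the oracle that are used for `boxesApprox`. -/
def boxesUse (k : ℕ) (L : List (List Bool × List Bool)) : ℕ :=
  ((words (maxLen L)).map (use k)).sum

lemma primrec_boxesUse : Primrec₂ boxesUse := by
  have h : Primrec fun y : (ℕ × List (List Bool × List Bool)) × List Bool => use y.1.1 y.2 :=
    primrec_use.comp (Primrec.fst.comp Primrec.fst) Primrec.snd
  exact (primrec_list_sum.comp (Primrec.list_map
    (primrec_words.comp (primrec_maxLen.comp Primrec.snd)) h.to₂)).to₂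

lemma abs_sum_map_sub_le {α : Type*} (l : List α) (f g : α → ℝ) {c : ℝ}
    (h : ∀ a ∈ l, |f a - g a| ≤ c) : |(l.map f).sum - (l.map g).sum| ≤ l.length * c := by
  induction l with
  | nil => simp
  | cons a l ih =>
    have h1 := ih fun b hb => h b (List.mem_cons_of_mem _ hb)
    have h2 := h a List.mem_cons_self
    rw [abs_le] at *
    simp only [List.map_cons, List.sum_cons, List.length_cons, Nat.cast_add, Nat.cast_one]
    constructor <;> linarith

/-- The constant in the error bound for `boxesApprox`. -/
def boxesConst (L : List (List Bool × List Bool)) : ℕ :=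
  (words (maxLen L)).length * ((words (maxLen L)).length * (4 * maxLen L))

lemma primrec_boxesConst : Primrec boxesConst := by
  have h : Primrec fun L => (words (maxLen L)).length :=
    Primrec.list_length.comp (primrec_words.comp primrec_maxLen)
  exact Primrec.nat_mul.comp h (Primrec.nat_mul.comp h
    (Primrec.nat_mul.comp (Primrec.const 4) primrec_maxLen))

lemma boxesApprox_error (R : Cantor) {n k : ℕ} {L : List (List Bool × List Bool)}
    (h : boxesUse k L ≤ n) :
    |2 ^ (k + 1) * 2 ^ (k + 1) * (rhoSq R).real (boxes L) - boxesApprox (PiNat.res R n) k L| ≤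
      boxesConst L * 2 ^ (k + 1) := by
  have huse : ∀ s ∈ words (maxLen L), use k s ≤ n := fun s hs =>
    (List.le_sum_of_mem (List.mem_map_of_mem hs)).trans h
  have hM : (0 : ℝ) ≤ 2 ^ (k + 1) := by positivity
  have hprod : ∀ s ∈ words (maxLen L), ∀ t ∈ words (maxLen L),
      |2 ^ (k + 1) * 2 ^ (k + 1) * (if covered L s t = true then mass R s * mass R t else 0) -
        ((if covered L s t = true then massApprox (PiNat.res R n) k s *
          massApprox (PiNat.res R n) k t else 0 : ℕ) : ℝ)| ≤ 4 * maxLen L * 2 ^ (k + 1) := by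
    intro s hs t ht
    have h1 := massApprox_error R (huse s hs)
    have h2 := massApprox_error R (huse t ht)
    rw [mem_words.1 hs] at h1
    rw [mem_words.1 ht] at h2
    have h3 : (massApprox (PiNat.res R n) k t : ℝ) ≤ 2 ^ (k + 1) := by
      exact_mod_cast massApprox_le _ _ _
    split_ifs
    -- Both factors are at most `2 ^ (k + 1)` and both errors at most twice the length, which gives
    -- the 4 in `boxesConst`.
    · have e : 2 ^ (k + 1) * 2 ^ (k + 1) * (mass R s * mass R t) -
          ((massApprox (PiNat.res R n) k s * massApprox (PiNat.res R n) k t : ℕ) : ℝ) =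
          2 ^ (k + 1) * mass R s * (2 ^ (k + 1) * mass R t - massApprox (PiNat.res R n) k t) +
          (2 ^ (k + 1) * mass R s - massApprox (PiNat.res R n) k s) *
            massApprox (PiNat.res R n) k t := by
        push_cast
        ring
      rw [e]
      refine (abs_add_le _ _).trans ?_
      rw [abs_mul (2 ^ (k + 1) * mass R s), abs_of_nonneg (mul_nonneg hM (mass_nonneg R s)),
        abs_mul (2 ^ (k + 1) * mass R s - _), Nat.abs_cast]
      have h4 : 2 ^ (k + 1) * mass R s ≤ 2 ^ (k + 1) := mul_le_of_le_one_right hM (mass_le_one R s)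
      have h5 := mul_le_mul h4 h2 (abs_nonneg _) hM
      have h6 := mul_le_mul h1 h3 (Nat.cast_nonneg _) (by positivity)
      linarith
    · simp only [mul_zero, Nat.cast_zero, sub_zero, abs_zero]
      positivity
  rw [rhoSq_boxes, boxesApprox, ← List.sum_map_mul_left, Nat.cast_list_sum, List.map_map]
  refine (abs_sum_map_sub_le _ _ _ (c := (words (maxLen L)).length * (4 * maxLen L * 2 ^ (k + 1)))
    fun s hs => ?_).trans (le_of_eq ?_)
  · simp only [Function.comp_apply]
    rw [← List.sum_map_mul_left, Nat.cast_list_sum, List.map_map]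
    exact abs_sum_map_sub_le _ _ _ fun t ht => hprod s hs t ht
  · simp only [boxesConst]
    push_cast
    ring

lemma exists_const_lt (c : ℕ) {ε : ℝ} (hε : 0 < ε) : ∃ k : ℕ, (c : ℝ) < ε * 2 ^ (k + 1) := by
  obtain ⟨k, hk⟩ := pow_unbounded_of_one_lt ((c : ℝ) / ε) (one_lt_two (α := ℝ))
  refine ⟨k, ?_⟩
  rw [div_lt_iff₀ hε] at hk
  have : (0 : ℝ) < 2 ^ k * ε := by positivity
  rw [pow_succ]
  linarith

/-- The fraction is left unreduced to match the powers `2 ^ (k + 1)` of `primrec_two_pow`. -/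
lemma toReal_two_inv_pow (m : ℕ) : ((2⁻¹ : ENNReal) ^ m).toReal = 2 / 2 ^ (m + 1) := by
  rw [ENNReal.toReal_pow, ENNReal.toReal_inv, ENNReal.toReal_ofNat, pow_succ, inv_pow]
  field_simp

/-- The common part of the two comparisons of a measure with `2⁻ᵐ`: some precision `k` at which an
integer inequality holds between the approximation, its error bound and the cleared denominators. -/
lemma ce_compare {c : (ℕ × ℕ) × (ℕ × ℕ) → Bool} (hc : Primrec c) :
    CE fun R (x : List (List Bool × List Bool) × ℕ) => ∃ k,
      c ((boxesApprox (PiNat.res R (boxesUse k x.1)) k x.1, boxesConst x.1 * 2 ^ (k + 1)),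
        (2 * (2 ^ (k + 1) * 2 ^ (k + 1)), 2 ^ (x.2 + 1))) = true := by
  have hL : Primrec fun y : ((List (List Bool × List Bool) × ℕ) × ℕ) × List Bool => y.1.1.1 :=
    Primrec.fst.comp (Primrec.fst.comp Primrec.fst)
  have hk : Primrec fun y : ((List (List Bool × List Bool) × ℕ) × ℕ) × List Bool => y.1.2 :=
    Primrec.snd.comp Primrec.fst
  have hM := primrec_two_pow.comp hk
  have hm : Primrec fun y : ((List (List Bool × List Bool) × ℕ) × ℕ) × List Bool =>
      2 ^ (y.1.1.2 + 1) :=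
    primrec_two_pow.comp (Primrec.snd.comp (Primrec.fst.comp Primrec.fst))
  have hA : Primrec fun y : ((List (List Bool × List Bool) × ℕ) × ℕ) × List Bool =>
      boxesApprox y.2 y.1.2 y.1.1.1 :=
    primrec_boxesApprox.comp ((Primrec.snd.pair hk).pair hL)
  have h : Primrec fun y : ((List (List Bool × List Bool) × ℕ) × ℕ) × List Bool =>
      c ((boxesApprox y.2 y.1.2 y.1.1.1, boxesConst y.1.1.1 * 2 ^ (y.1.2 + 1)),
        (2 * (2 ^ (y.1.2 + 1) * 2 ^ (y.1.2 + 1)), 2 ^ (y.1.1.2 + 1))) :=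
    hc.comp ((hA.pair (Primrec.nat_mul.comp (primrec_boxesConst.comp hL) hM)).pair
      ((Primrec.nat_mul.comp (Primrec.const 2) (Primrec.nat_mul.comp hM hM)).pair hm))
  have hu : Primrec fun y : (List (List Bool × List Bool) × ℕ) × ℕ => boxesUse y.2 y.1.1 :=
    primrec_boxesUse.comp Primrec.snd (Primrec.fst.comp Primrec.fst)
  exact ((CE.of_primrec h).subst_res hu).exists

/-- That a finite union of rectangles has small measure is enumerable in the representation. -/
lemma ce_rhoSq_lt : CE fun R (x : List (List Bool × List Bool) × ℕ) =>
    rhoSq R (boxes x.1) < (2⁻¹ : ENNReal) ^ x.2 := by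
  refine (ce_compare (c := fun x => decide ((x.1.1 + x.1.2) * x.2.2 < x.2.1)) ?_).of_eq ?_
  · exact primrec_decide_lt (Primrec.nat_mul.comp (Primrec.nat_add.comp
      (Primrec.fst.comp Primrec.fst) (Primrec.snd.comp Primrec.fst))
      (Primrec.snd.comp Primrec.snd)) (Primrec.fst.comp Primrec.snd)
  · rintro R ⟨L, m⟩
    rw [← ENNReal.toReal_lt_toReal (measure_ne_top _ _) (by simp), toReal_two_inv_pow,
      ← measureReal_def, lt_div_iff₀ (by positivity)]
    have herr : ∀ k, _ := fun k => boxesApprox_error R (k := k) (L := L) le_rfl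
    simp only [decide_eq_true_eq, abs_le] at herr ⊢
    rw [← sub_pos]
    have hm : (0 : ℝ) < 2 ^ (m + 1) := by positivity
    constructor
    · rintro ⟨k, hk⟩
      have hk' : ((boxesApprox (PiNat.res R (boxesUse k L)) k L : ℝ) +
        boxesConst L * 2 ^ (k + 1)) * 2 ^ (m + 1) < 2 * (2 ^ (k + 1) * 2 ^ (k + 1)) := by
        exact_mod_cast hk
      have hM : (0 : ℝ) < 2 ^ (k + 1) * 2 ^ (k + 1) := by positivity
      refine pos_of_mul_pos_right (a := 2 ^ (k + 1) * 2 ^ (k + 1)) ?_ hM.le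
      have := mul_le_mul_of_nonneg_right (herr k).2 hm.le
      linarith
    · intro h
      -- The factor 2 is there because the error enters twice: in the approximation itself and in
      -- the safety margin of the test.
      obtain ⟨k, hk⟩ := exists_const_lt (2 * boxesConst L * 2 ^ (m + 1)) h
      refine ⟨k, ?_⟩
      have hM : (0 : ℝ) < 2 ^ (k + 1) := by positivity
      have h1 := mul_le_mul_of_nonneg_right (herr k).1 hm.le
      have h2 := mul_lt_mul_of_pos_right hk hM
      push_cast at h2
      have : ((boxesApprox (PiNat.res R (boxesUse k L)) k L : ℝ) +
        boxesConst L * 2 ^ (k + 1)) * 2 ^ (m + 1) < 2 * (2 ^ (k + 1) * 2 ^ (k + 1)) := by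
        linarith
      exact_mod_cast this

/-- That a finite union of rectangles has large measure is enumerable in the representation. -/
lemma ce_lt_rhoSq : CE fun R (x : List (List Bool × List Bool) × ℕ) =>
    (2⁻¹ : ENNReal) ^ x.2 < rhoSq R (boxes x.1) := by
  refine (ce_compare (c := fun x => decide (x.2.1 + x.1.2 * x.2.2 < x.1.1 * x.2.2)) ?_).of_eq ?_
  · exact primrec_decide_lt (Primrec.nat_add.comp (Primrec.fst.comp Primrec.snd)
      (Primrec.nat_mul.comp (Primrec.snd.comp Primrec.fst) (Primrec.snd.comp Primrec.snd)))
      (Primrec.nat_mul.comp (Primrec.fst.comp Primrec.fst) (Primrec.snd.comp Primrec.snd))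
  · rintro R ⟨L, m⟩
    rw [← ENNReal.toReal_lt_toReal (by simp) (measure_ne_top _ _), toReal_two_inv_pow,
      ← measureReal_def, div_lt_iff₀ (by positivity)]
    have herr : ∀ k, _ := fun k => boxesApprox_error R (k := k) (L := L) le_rfl
    simp only [decide_eq_true_eq, abs_le] at herr ⊢
    rw [← sub_pos]
    have hm : (0 : ℝ) < 2 ^ (m + 1) := by positivity
    constructor
    · rintro ⟨k, hk⟩
      have hk' : (2 : ℝ) * (2 ^ (k + 1) * 2 ^ (k + 1)) + boxesConst L * 2 ^ (k + 1) * 2 ^ (m + 1) <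
          boxesApprox (PiNat.res R (boxesUse k L)) k L * 2 ^ (m + 1) := by
        exact_mod_cast hk
      have hM : (0 : ℝ) < 2 ^ (k + 1) * 2 ^ (k + 1) := by positivity
      refine pos_of_mul_pos_right (a := 2 ^ (k + 1) * 2 ^ (k + 1)) ?_ hM.le
      have := mul_le_mul_of_nonneg_right (herr k).1 hm.le
      linarith
    · intro h
      obtain ⟨k, hk⟩ := exists_const_lt (2 * boxesConst L * 2 ^ (m + 1)) h
      refine ⟨k, ?_⟩
      have hM : (0 : ℝ) < 2 ^ (k + 1) := by positivity
      have h1 := mul_le_mul_of_nonneg_right (herr k).2 hm.le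
      have h2 := mul_lt_mul_of_pos_right hk hM
      push_cast at h2
      have : (2 : ℝ) * (2 ^ (k + 1) * 2 ^ (k + 1)) + boxesConst L * 2 ^ (k + 1) * 2 ^ (m + 1) <
          boxesApprox (PiNat.res R (boxesUse k L)) k L * 2 ^ (m + 1) := by
        linarith
      exact_mod_cast this

/-! ### Tests -/

/-- The stages that survive form a directed family, so the measure of their union is the supremum of
theirs. This turns an arbitrary enumeration into one that obeys the bound `c`. -/
lemma measure_cutoff {Ω : Type*} [MeasurableSpace Ω] (ν : Measure Ω) {D : ℕ → Set Ω}
    (hD : Monotone D) (c : ENNReal) : ν (⋃ j, ⋃ (_ : ν (D j) < c), D j) ≤ c := by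
  have hdir : Directed (· ⊆ ·) fun j => ⋃ (_ : ν (D j) < c), D j := by
    intro i j
    by_cases hi : ν (D i) < c
    · by_cases hj : ν (D j) < c
      · rcases le_total i j with h | h
        · exact ⟨j, by simpa [hi, hj] using hD h, subset_rfl⟩
        · exact ⟨i, subset_rfl, by simpa [hi, hj] using hD h⟩
      · exact ⟨i, subset_rfl, by simp [hj]⟩
    · exact ⟨j, by simp [hi], subset_rfl⟩
  rw [hdir.measure_iUnion]
  refine iSup_le fun j => ?_
  by_cases hj : ν (D j) < c
  · simpa [hj] using hj.le
  · simp [hj]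

/-- The cut-off demands a strict inequality while tests have weak bounds. Passing to the next level
of a test makes room, so a genuine test is never cut off. -/
lemma two_inv_pow_lt (n : ℕ) : (2⁻¹ : ENNReal) ^ (n + 1) < 2⁻¹ ^ n := by
  rw [← ENNReal.toReal_lt_toReal (by simp) (by simp), toReal_two_inv_pow, toReal_two_inv_pow]
  have : (0 : ℝ) < 2 ^ (n + 1) := by positivity
  rw [pow_succ 2 (n + 1)]
  exact div_lt_div_of_pos_left two_pos this (by linarith)

/-- The union of finitely many basic clopen sets. -/
def cyls (l : List (List Bool)) : Set Cantor := ⋃ σ ∈ l, cyl σ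

lemma mem_cyls {l : List (List Bool)} {X : Cantor} : X ∈ cyls l ↔ ∃ σ ∈ l, X ∈ cyl σ := by
  simp only [cyls, Set.mem_iUnion, exists_prop]

/-- This reduces the computation of measures on Cantor space to the one on the product. -/
lemma rhoSq_boxes_map (R : Cantor) (l : List (List Bool)) :
    rhoSq R (boxes (l.map fun σ => (σ, []))) = (rho R : Measure Cantor) (cyls l) := by
  have : boxes (l.map fun σ => (σ, [])) = cyls l ×ˢ Set.univ := by
    ext z
    simp only [mem_boxes, List.mem_map, Set.mem_prod, mem_cyls, Set.mem_univ, and_true]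
    constructor
    · rintro ⟨_, ⟨σ, hσ, rfl⟩, h, -⟩
      exact ⟨σ, hσ, h⟩
    · rintro ⟨σ, hσ, h⟩
      exact ⟨_, ⟨σ, hσ, rfl⟩, h, by simp [cyl_nil]⟩
  rw [this, rhoSq, Measure.prod_prod, measure_univ, mul_one]

lemma primrec_map_nil : Primrec fun x : List (List Bool) × ℕ =>
    (x.1.map fun σ => (σ, ([] : List Bool)), x.2) := by
  have h : Primrec fun y : (List (List Bool) × ℕ) × List Bool => (y.2, ([] : List Bool)) :=
    Primrec.snd.pair (Primrec.const [])
  exact (Primrec.list_map Primrec.fst h.to₂).pair Primrec.snd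

lemma ce_rho_lt : CE fun R (x : List (List Bool) × ℕ) =>
    (rho R : Measure Cantor) (cyls x.1) < (2⁻¹ : ENNReal) ^ x.2 :=
  (ce_rhoSq_lt.comp primrec_map_nil).of_eq fun R x => by simp only [rhoSq_boxes_map]

lemma ce_lt_rho : CE fun R (x : List (List Bool) × ℕ) =>
    (2⁻¹ : ENNReal) ^ x.2 < (rho R : Measure Cantor) (cyls x.1) :=
  (ce_lt_rhoSq.comp primrec_map_nil).of_eq fun R x => by simp only [rhoSq_boxes_map]

lemma CE.uniformlySigmaOne {P : Cantor → ℕ × List Bool → Prop} (hP : CE P) (Z : Cantor) :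
    UniformlySigmaOne Z fun n => {X | ∃ σ, P Z (n, σ) ∧ X ∈ cyl σ} :=
  ⟨fun n => {σ | P Z (n, σ)}, hP.reIn Z, fun n => by ext; simp⟩

lemma UniformlySigmaOne.exists_ce {Z : Cantor} {V : ℕ → Set Cantor} (h : UniformlySigmaOne Z V) :
    ∃ P : Cantor → ℕ × List Bool → Prop, CE P ∧
      ∀ n X, X ∈ V n ↔ ∃ σ, P Z (n, σ) ∧ X ∈ cyl σ := by
  obtain ⟨W, hW, hV⟩ := h
  obtain ⟨P, hP, hPW⟩ := hW.exists_ce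
  exact ⟨P, hP, fun n X => by simp [hV, hPW]⟩

lemma CE.uniformlySigmaOneProd {P : Cantor → ℕ × (List Bool × List Bool) → Prop} (hP : CE P)
    (Z : Cantor) : UniformlySigmaOneProd Z fun n =>
      {z | ∃ x : List Bool × List Bool, P Z (n, x) ∧ z.1 ∈ cyl x.1 ∧ z.2 ∈ cyl x.2} :=
  ⟨fun n => {x | P Z (n, x)}, hP.reIn Z, fun n => by
    ext z
    simp only [Set.mem_ofPred_eq, Set.mem_iUnion, Set.mem_prod, exists_prop]⟩

lemma UniformlySigmaOneProd.exists_ce {Z : Cantor} {V : ℕ → Set (Cantor × Cantor)}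
    (h : UniformlySigmaOneProd Z V) :
    ∃ P : Cantor → ℕ × (List Bool × List Bool) → Prop, CE P ∧
      ∀ n z, z ∈ V n ↔ ∃ x : List Bool × List Bool, P Z (n, x) ∧ z.1 ∈ cyl x.1 ∧ z.2 ∈ cyl x.2 := by
  obtain ⟨W, hW, hV⟩ := h
  obtain ⟨P, hP, hPW⟩ := hW.exists_ce
  refine ⟨P, hP, fun n z => ?_⟩
  simp only [hV, hPW, Set.mem_iUnion, Set.mem_prod, exists_prop]

lemma UniformlySigmaOneProd.isOpen {Z : Cantor} {V : ℕ → Set (Cantor × Cantor)}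
    (h : UniformlySigmaOneProd Z V) (n : ℕ) : IsOpen (V n) := by
  obtain ⟨W, -, hV⟩ := h
  rw [hV]
  exact isOpen_biUnion fun _ _ => (isClopen_cyl _).isOpen.prod (isClopen_cyl _).isOpen

lemma MLRProd.swap {μ : ProbabilityMeasure Cantor} {A B : Cantor} (h : (A, B) ∈ MLRProd μ) :
    (B, A) ∈ MLRProd μ := by
  obtain ⟨R, hR, h⟩ := h
  refine ⟨R, hR, fun V hV hBA => h (fun n => Prod.swap ⁻¹' V n) ⟨?_, fun n => ?_⟩ ?_⟩
  · obtain ⟨P, hP, hPV⟩ := hV.1.exists_ce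
    have hs : Primrec fun x : ℕ × (List Bool × List Bool) => (x.1, (x.2.2, x.2.1)) :=
      Primrec.fst.pair ((Primrec.snd.comp Primrec.snd).pair (Primrec.fst.comp Primrec.snd))
    convert (hP.comp hs).uniformlySigmaOneProd _ using 1
    funext n
    ext z
    simp only [Set.mem_preimage, hPV, Prod.fst_swap, Prod.snd_swap, Set.mem_ofPred_eq]
    constructor
    · rintro ⟨x, h1, h2, h3⟩
      exact ⟨x.swap, h1, h3, h2⟩
    · rintro ⟨x, h1, h2, h3⟩
      exact ⟨x.swap, h1, h3, h2⟩
  · rw [(Measure.measurePreserving_swap).measure_preimage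
      (hV.1.isOpen n).measurableSet.nullMeasurableSet]
    exact hV.2 n
  · simpa using hBA

/-! ### From randomness on the product to relative randomness -/

lemma primrec_list_mem {α β : Type*} [Primcodable α] [Primcodable β] [DecidableEq β]
    {f : α → β} {l : α → List β} (hf : Primrec f) (hl : Primrec l) :
    Primrec fun a => decide (f a ∈ l a) := by
  have h : Primrec fun y : α × β => decide (y.2 = f y.1) :=
    primrec_decide_eq Primrec.snd (hf.comp Primrec.fst)
  refine (primrec_list_any hl h.to₂).of_eq fun a => ?_
  rw [Bool.eq_iff_iff]
  simp

/-- If a pair passes the tests on the product space, its first component is random relative to the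
second one, for the same representation of the measure. -/
lemma isRandom_of_forall_isProdTest {R A B : Cantor}
    (h : ∀ V, IsProdTest R V → (A, B) ∉ ⋂ n, V n) : IsRandom R B A := by
  rintro V ⟨hV, hVμ⟩ hA
  obtain ⟨P, hP, hPV⟩ := hV.exists_ce
  obtain ⟨E, hE, hEmono, hEP⟩ := hP.exists_enum
  -- The second word of a rectangle supplies the bits of the variable `Y` in the oracle `R ⊕ Y`, and
  -- its length is the stage.
  have hw : Primrec fun y : (ℕ × (List Bool × List Bool)) × List Bool =>
      E (joinWord y.2 y.1.2.2, y.1.1 + 1) :=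
    hE.comp ((primrec_joinWord.comp Primrec.snd
      (Primrec.snd.comp (Primrec.snd.comp Primrec.fst))).pair
      (Primrec.succ.comp (Primrec.fst.comp Primrec.fst)))
  have hmem : Primrec fun y : (ℕ × (List Bool × List Bool)) × List Bool =>
      decide (y.1.2.1 ∈ E (joinWord y.2 y.1.2.2, y.1.1 + 1)) :=
    (primrec_list_mem (Primrec.fst.comp (Primrec.snd.comp Primrec.fst)) hw).of_eq fun _ =>
      decide_eq_decide.2 Iff.rfl
  have hlen : Primrec fun x : ℕ × (List Bool × List Bool) => x.2.2.length :=
    Primrec.list_length.comp (Primrec.snd.comp Primrec.snd)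
  have hQ := ((CE.of_primrec hmem).and
    (ce_rho_lt.comp (hw.pair (Primrec.fst.comp Primrec.fst)))).subst_res hlen
  have hU := (hQ.comp_half 0).uniformlySigmaOneProd (join R emptyReal)
  simp only [half_zero_join, decide_eq_true_eq] at hU
  refine h _ ⟨hU, fun n => ?_⟩ ?_
  -- By Fubini it is enough to bound the section over each `Y`, a union of stages that survive the
  -- cut-off.
  · rw [Measure.prod_apply_symm (hU.isOpen n).measurableSet]
    refine (lintegral_mono (g := fun _ => (2⁻¹ : ENNReal) ^ n) fun Y => ?_).trans (by simp)
    have hD : Monotone fun j => cyls (E (PiNat.res (join R Y) (2 * j), n + 1)) := by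
      intro i j hij X
      simp only [mem_cyls]
      rintro ⟨σ, h1, h2⟩
      exact ⟨σ, hEmono _ _ _ _ (by omega) _ h1, h2⟩
    refine (measure_mono ?_).trans (measure_cutoff (rho R : Measure Cantor) hD (2⁻¹ ^ n))
    rintro X ⟨⟨σ, τ⟩, ⟨h1, h2⟩, h3, h4⟩
    have e : PiNat.res Y τ.length = τ := h4
    have e' : joinWord (PiNat.res R τ.length) τ = PiNat.res (join R Y) (2 * τ.length) := by
      rw [res_join, e]
    simp only [e'] at h1 h2
    simp only [Set.mem_iUnion, exists_prop]
    exact ⟨τ.length, h2, mem_cyls.2 ⟨σ, h1, h3⟩⟩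
  · refine Set.mem_iInter.2 fun n => ?_
    obtain ⟨σ, h1, h2⟩ := (hPV _ _).1 (Set.mem_iInter.1 hA (n + 1))
    obtain ⟨m, hm⟩ := (hEP _ _ _).1 h1
    have e : joinWord (PiNat.res R m) (PiNat.res B m) = PiNat.res (join R B) (2 * m) :=
      (res_join _ _ _).symm
    refine ⟨(σ, PiNat.res B m), ⟨?_, ?_⟩, h2, mem_cyl_res _ _⟩
    · simp only [PiNat.res_length, e]
      exact hEmono _ _ _ _ (by omega) _ hm
    · simp only [PiNat.res_length, e]
      -- Over `Y = B` every stage is part of `V (n + 1)`, so the cut-off never takes effect.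
      refine (measure_mono fun X hX => ?_).trans_lt ((hVμ (n + 1)).trans_lt (two_inv_pow_lt n))
      obtain ⟨σ', h3, h4⟩ := mem_cyls.1 hX
      exact (hPV _ _).2 ⟨σ', (hEP _ _ _).2 ⟨_, h3⟩, h4⟩

lemma relativelyRandom_of_mem_mLRProd {μ : ProbabilityMeasure Cantor} {A B : Cantor}
    (h : (A, B) ∈ MLRProd μ) : RelativelyRandom μ A B := by
  obtain ⟨R, hR, h1⟩ := h
  obtain ⟨S, hS, h2⟩ := MLRProd.swap ⟨R, hR, h1⟩
  exact ⟨⟨R, hR, isRandom_of_forall_isProdTest h1⟩, ⟨S, hS, isRandom_of_forall_isProdTest h2⟩⟩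

/-! ### A universal test on the product space -/

/-- The union of the basic rectangles with `P`. -/
def rect (P : List Bool × List Bool → Prop) : Set (Cantor × Cantor) :=
  {z | ∃ x : List Bool × List Bool, P x ∧ z.1 ∈ cyl x.1 ∧ z.2 ∈ cyl x.2}

lemma isOpen_rect (P : List Bool × List Bool → Prop) : IsOpen (rect P) := by
  have : rect P = ⋃ x ∈ {x | P x}, cyl x.1 ×ˢ cyl x.2 := by
    ext z
    simp only [rect, Set.mem_ofPred_eq, Set.mem_iUnion, Set.mem_prod, exists_prop]
  rw [this]
  exact isOpen_biUnion fun _ _ => (isClopen_cyl _).isOpen.prod (isClopen_cyl _).isOpen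

lemma tsum_two_inv_pow (n : ℕ) : ∑' m, (2⁻¹ : ENNReal) ^ (n + m + 1) = 2⁻¹ ^ n := by
  have : ∀ m, (2⁻¹ : ENNReal) ^ (n + m + 1) = 2⁻¹ ^ (n + 1) * 2⁻¹ ^ m := fun m => by ring
  simp only [this]
  rw [ENNReal.tsum_mul_left, ENNReal.tsum_geometric, ENNReal.one_sub_inv_two, inv_inv, pow_succ,
    mul_assoc, ENNReal.inv_mul_cancel (by simp) (by simp), mul_one]

/-- There is a test on the product space, uniformly in the representation `R`, that captures
whatever an `(R, ∅)`-test captures. -/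
lemma exists_universal_test : ∃ U : Cantor → ℕ × (List Bool × List Bool) → Prop, CE U ∧
    (∀ R n, rhoSq R (rect fun x => U R (n, x)) ≤ 2⁻¹ ^ n) ∧
    ∀ R V, IsProdTest R V → ∀ z ∈ ⋂ n, V n, ∀ n, z ∈ rect fun x => U R (n, x) := by
  have hassoc : Primrec fun y : (ℕ × ℕ) × (List Bool × List Bool) => (y.1.1, (y.1.2, y.2)) :=
    (Primrec.fst.comp Primrec.fst).pair ((Primrec.snd.comp Primrec.fst).pair Primrec.snd)
  obtain ⟨E, hE, hEmono, hEP⟩ := (ce_univ.comp hassoc).exists_enum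
  have he : Primrec fun y : (((ℕ × (List Bool × List Bool)) × ℕ) × ℕ) × List Bool =>
      y.1.1.2 := Primrec.snd.comp (Primrec.fst.comp Primrec.fst)
  have hn : Primrec fun y : (((ℕ × (List Bool × List Bool)) × ℕ) × ℕ) × List Bool =>
      y.1.1.1.1 + y.1.1.2 + 1 := Primrec.succ.comp (Primrec.nat_add.comp (Primrec.fst.comp
        (Primrec.fst.comp (Primrec.fst.comp Primrec.fst))) he)
  have hw : Primrec fun y : (((ℕ × (List Bool × List Bool)) × ℕ) × ℕ) × List Bool =>
      E (y.2, (y.1.1.2, y.1.1.1.1 + y.1.1.2 + 1 + 1)) :=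
    (hE.comp (Primrec.snd.pair (he.pair (Primrec.succ.comp hn))) :)
  have hmem : Primrec fun y : (((ℕ × (List Bool × List Bool)) × ℕ) × ℕ) × List Bool =>
      decide (y.1.1.1.2 ∈ E (y.2, (y.1.1.2, y.1.1.1.1 + y.1.1.2 + 1 + 1))) :=
    (primrec_list_mem (Primrec.snd.comp (Primrec.fst.comp (Primrec.fst.comp Primrec.fst)))
      hw).of_eq fun _ => decide_eq_decide.2 Iff.rfl
  have hj : Primrec fun y : ((ℕ × (List Bool × List Bool)) × ℕ) × ℕ => y.2 := Primrec.snd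
  -- The `e`-th enumeration is kept below `2⁻¹ ^ (n + e + 1)`, and these bounds add up to `2⁻¹ ^ n`.
  -- It is read one level further down, at `n + e + 1 + 1`, so that genuine tests stay strictly
  -- below the bound.
  have hU := (((CE.of_primrec hmem).and (ce_rhoSq_lt.comp (hw.pair hn))).subst_res hj).exists.exists
  simp only [decide_eq_true_eq] at hU
  refine ⟨_, hU, fun R n => ?_, fun R V hV z hz n => ?_⟩
  · have hD : ∀ e, Monotone fun j => boxes (E (PiNat.res R j, (e, n + e + 1 + 1))) := by
      intro e i j hij z
      simp only [mem_boxes]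
      rintro ⟨x, h1, h2⟩
      exact ⟨x, hEmono _ _ _ _ hij _ h1, h2⟩
    rw [← tsum_two_inv_pow]
    refine (measure_mono ?_).trans ((measure_iUnion_le _).trans
      (ENNReal.tsum_le_tsum fun e => measure_cutoff (rhoSq R) (hD e) (2⁻¹ ^ (n + e + 1))))
    rintro z ⟨x, ⟨e, j, h1, h2⟩, h3⟩
    simp only [Set.mem_iUnion, exists_prop]
    exact ⟨e, j, h2, mem_boxes.2 ⟨x, h1, h3⟩⟩
  · obtain ⟨P, hP, hPV⟩ := hV.1.exists_ce
    obtain ⟨e, he⟩ := hP.comp_join_empty.exists_univ_eq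
    obtain ⟨x, h1, h2⟩ := (hPV _ _).1 (Set.mem_iInter.1 hz (n + e + 1 + 1))
    obtain ⟨j, hj⟩ := (hEP R (e, n + e + 1 + 1) x).1 ((he _ _).2 h1)
    refine ⟨x, ⟨e, j, hj, ?_⟩, h2⟩
    refine (measure_mono fun y hy => ?_).trans_lt
      ((hV.2 (n + e + 1 + 1)).trans_lt (two_inv_pow_lt _))
    obtain ⟨x', h3, h4⟩ := mem_boxes.1 hy
    exact (hPV _ _).2 ⟨x', (he _ _).1 ((hEP R (e, n + e + 1 + 1) x').2 ⟨j, h3⟩), h4⟩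

/-! ### Representations of the same measure -/

lemma mass_eq_of_rho_eq {R S : Cantor} (h : rho R = rho S) (σ : List Bool) :
    mass R σ = mass S σ := by
  have := rho_cyl R σ
  rw [h, rho_cyl] at this
  exact ((ENNReal.ofReal_eq_ofReal_iff (mass_nonneg _ _) (mass_nonneg _ _)).1 this).symm

lemma rho_eq_of_mass_eq {R S : Cantor} (h : ∀ σ, mass R σ = mass S σ) : rho R = rho S := by
  have hbasis : TopologicalSpace.IsTopologicalBasis (Set.range cyl) := by
    refine TopologicalSpace.isTopologicalBasis_of_isOpen_of_nhds ?_ fun X U hX hU => ?_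
    · rintro _ ⟨σ, rfl⟩
      exact (isClopen_cyl σ).isOpen
    · obtain ⟨s, h1, h2, h3⟩ := exists_cyl_subset hU hX
      exact ⟨s, h1, mem_of_mem_nhds h2, h3⟩
  apply Subtype.ext
  have hfin : IsProbabilityMeasure (rho R).1 := (rho R).2
  refine ext_of_generate_finite (Set.range cyl) ?_ isPiSystem_cyl ?_ ?_
  · rw [BorelSpace.measurable_eq (α := Cantor)]
    exact hbasis.borel_eq_generateFrom
  · rintro _ ⟨σ, rfl⟩
    change (rho R : Measure Cantor) _ = (rho S : Measure Cantor) _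
    rw [rho_cyl, rho_cyl, h]
  · change (rho R : Measure Cantor) _ = (rho S : Measure Cantor) _
    rw [measure_univ, measure_univ]

/-- Some initial segment `v` of `r` shows that no extension of `r` represents the same measure as
`S`. -/
def Refuted (S : Cantor) (r : List Bool) : Prop :=
  ∃ (k : ℕ) (σ v : List Bool), (v <:+ r ∧ use k σ ≤ v.length) ∧
    (massApprox v k σ + 4 * σ.length < massApprox (PiNat.res S (use k σ)) k σ ∨
      massApprox (PiNat.res S (use k σ)) k σ + 4 * σ.length < massApprox v k σ)

lemma ce_refuted : CE Refuted := by
  have hr : Primrec fun y : (((List Bool × ℕ) × List Bool) × List Bool) × List Bool =>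
      y.1.1.1.1 := Primrec.fst.comp (Primrec.fst.comp (Primrec.fst.comp Primrec.fst))
  have hk : Primrec fun y : (((List Bool × ℕ) × List Bool) × List Bool) × List Bool =>
      y.1.1.1.2 := Primrec.snd.comp (Primrec.fst.comp (Primrec.fst.comp Primrec.fst))
  have hσ : Primrec fun y : (((List Bool × ℕ) × List Bool) × List Bool) × List Bool =>
      y.1.1.2 := Primrec.snd.comp (Primrec.fst.comp Primrec.fst)
  have hv : Primrec fun y : (((List Bool × ℕ) × List Bool) × List Bool) × List Bool =>
      y.1.2 := Primrec.snd.comp Primrec.fst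
  have hl : Primrec fun y : (((List Bool × ℕ) × List Bool) × List Bool) × List Bool =>
      4 * y.1.1.2.length :=
    Primrec.nat_mul.comp (Primrec.const 4) (Primrec.list_length.comp hσ)
  have hm : Primrec fun y : (((List Bool × ℕ) × List Bool) × List Bool) × List Bool =>
      massApprox y.1.2 y.1.1.1.2 y.1.1.2 := (primrec_massApprox.comp ((hv.pair hk).pair hσ) :)
  have hm' : Primrec fun y : (((List Bool × ℕ) × List Bool) × List Bool) × List Bool =>
      massApprox y.2 y.1.1.1.2 y.1.1.2 :=
    (primrec_massApprox.comp ((Primrec.snd.pair hk).pair hσ) :)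
  have h1 := primrec_decide_eq hv (Primrec.list_drop.comp (Primrec.nat_sub.comp
    (Primrec.list_length.comp hr) (Primrec.list_length.comp hv)) hr)
  have h2 := primrec_decide_le (primrec_use.comp hk hσ) (Primrec.list_length.comp hv)
  have h3 := primrec_decide_lt (Primrec.nat_add.comp hm hl) hm'
  have h4 := primrec_decide_lt (Primrec.nat_add.comp hm' hl) hm
  have hu : Primrec fun y : ((List Bool × ℕ) × List Bool) × List Bool => use y.1.1.2 y.1.2 :=
    primrec_use.comp (Primrec.snd.comp (Primrec.fst.comp Primrec.fst))
      (Primrec.snd.comp Primrec.fst)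
  refine ((((CE.of_primrec (Primrec.and.comp (Primrec.and.comp h1 h2)
    (Primrec.or.comp h3 h4))).subst_res hu).exists).exists.exists).of_eq fun S r => ?_
  simp only [Refuted, Bool.and_eq_true, Bool.or_eq_true, decide_eq_true_eq,
    List.suffix_iff_eq_drop]

lemma Refuted.mono {S : Cantor} {r r' : List Bool} (h : Refuted S r) (hr : r <:+ r') :
    Refuted S r' := by
  obtain ⟨k, σ, v, ⟨h1, h2⟩, h3⟩ := h
  exact ⟨k, σ, v, ⟨h1.trans hr, h2⟩, h3⟩

/-- Both approximations lie within `2 * σ.length` of the same scaled mass, so they cannot differ by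
more than `4 * σ.length`. -/
lemma not_refuted {R S : Cantor} (h : rho R = rho S) (n : ℕ) : ¬ Refuted S (PiNat.res R n) := by
  rintro ⟨k, σ, v, ⟨h1, h2⟩, h3⟩
  obtain ⟨m, rfl⟩ := mem_cyl_iff.1 (cyl_subset_of_suffix h1 (mem_cyl_res R n))
  rw [PiNat.res_length] at h2
  have e1 := massApprox_error R h2
  have e2 := massApprox_error S (le_refl (use k σ))
  rw [mass_eq_of_rho_eq h] at e1
  rw [abs_le] at e1 e2
  rcases h3 with h3 | h3
  · have h3' : (massApprox (PiNat.res R m) k σ : ℝ) + 4 * σ.length <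
        massApprox (PiNat.res S (use k σ)) k σ := by exact_mod_cast h3
    linarith
  · have h3' : (massApprox (PiNat.res S (use k σ)) k σ : ℝ) + 4 * σ.length <
        massApprox (PiNat.res R m) k σ := by exact_mod_cast h3
    linarith

/-- Different measures differ on a cylinder, and that difference, scaled by `2 ^ (k + 1)`,
eventually exceeds any constant. The constant `8 * σ.length` covers the gap demanded by `Refuted`
and the two approximation errors. -/
lemma exists_refuted {R S : Cantor} (h : rho R ≠ rho S) : ∃ n, Refuted S (PiNat.res R n) := by
  obtain ⟨σ, hσ⟩ : ∃ σ, mass R σ ≠ mass S σ := by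
    by_contra! hc
    exact h (rho_eq_of_mass_eq hc)
  obtain ⟨k, hk⟩ := exists_const_lt (8 * σ.length) (abs_pos.2 (sub_ne_zero.2 hσ))
  refine ⟨use k σ, k, σ, _, ⟨List.suffix_rfl, (PiNat.res_length _ _).ge⟩, ?_⟩
  have e1 := massApprox_error R (le_refl (use k σ))
  have e2 := massApprox_error S (le_refl (use k σ))
  rw [abs_le] at e1 e2
  push_cast at hk
  have hM : (0 : ℝ) < 2 ^ (k + 1) := by positivity
  rcases lt_or_gt_of_ne hσ with h | h
  · left
    rw [abs_of_neg (by linarith)] at hk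
    have : (massApprox (PiNat.res R (use k σ)) k σ : ℝ) + 4 * σ.length <
        massApprox (PiNat.res S (use k σ)) k σ := by linarith
    exact_mod_cast this
  · right
    rw [abs_of_pos (by linarith)] at hk
    have : (massApprox (PiNat.res S (use k σ)) k σ : ℝ) + 4 * σ.length <
        massApprox (PiNat.res R (use k σ)) k σ := by linarith
    exact_mod_cast this

lemma exists_res_eq (r : List Bool) : ∃ R, PiNat.res R r.length = r := by
  refine ⟨bit r, ?_⟩
  rw [res_eq_map, List.map_reverse, ← List.reverse_inj, List.reverse_reverse]
  refine List.ext_getElem (by simp) fun i h1 h2 => ?_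
  simp only [List.getElem_map, List.getElem_range, bit]
  rw [List.getD_eq_getElem _ _ h2]

lemma isOpen_setOf_res (p : List Bool → Prop) (n : ℕ) : IsOpen {R : Cantor | p (PiNat.res R n)} := by
  refine isOpen_iff_forall_mem_open.2 fun R hR => ?_
  refine ⟨cyl (PiNat.res R n), fun S hS => ?_, (isClopen_cyl _).isOpen, mem_cyl_res R n⟩
  have : PiNat.res S (PiNat.res R n).length = PiNat.res R n := hS
  rw [PiNat.res_length] at this
  simpa [this] using hR

/-- There is a test on the product space, uniformly in the representation but dependent only on the
measure, that captures all pairs that are not in `MLRProd`. -/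
lemma exists_extensional_test : ∃ P : Cantor → ℕ × (List Bool × List Bool) → Prop, CE P ∧
    (∀ S n σ σ' τ, σ <:+ σ' → P S (n, (σ, τ)) → P S (n, (σ', τ))) ∧
    (∀ S n, rhoSq S (rect fun x => P S (n, x)) ≤ 2⁻¹ ^ n) ∧
    (∀ S S', rho S = rho S' → ∀ n, (rect fun x => P S (n, x)) = rect fun x => P S' (n, x)) ∧
    ∀ S, ∀ z ∉ MLRProd (rho S), ∀ n, z ∈ rect fun x => P S (n, x) := by
  obtain ⟨U, hU, hUμ, hUuniv⟩ := exists_universal_test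
  obtain ⟨E, hE, hEmono, hEP⟩ := hU.exists_enum
  have hr : Primrec fun y : ((ℕ × (List Bool × List Bool)) × ℕ) × List Bool => y.2 := Primrec.snd
  have hx : Primrec fun y : ((ℕ × (List Bool × List Bool)) × ℕ) × List Bool => y.1.1.2 :=
    Primrec.snd.comp (Primrec.fst.comp Primrec.fst)
  have hn : Primrec fun y : ((ℕ × (List Bool × List Bool)) × ℕ) × List Bool => y.1.1.1 :=
    Primrec.fst.comp (Primrec.fst.comp Primrec.fst)
  have hc : Primrec fun y : ((ℕ × (List Bool × List Bool)) × ℕ) × List Bool =>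
      covered (E (y.2, y.1.1.1)) y.1.1.2.1 y.1.1.2.2 :=
    (primrec_covered.comp ((hE.comp (hr.pair hn)).pair hx) :)
  have hw : Primrec fun y : (ℕ × (List Bool × List Bool)) × ℕ => words y.2 :=
    primrec_words.comp Primrec.snd
  have hP := (((ce_refuted.comp hr).or (CE.of_primrec hc)).forall_mem hw).exists
  -- The enumerated set is the intersection over all representations of `rho S`, and so depends on
  -- the measure alone.
  have key : ∀ S n, (rect fun x => ∃ N, ∀ r ∈ words N, Refuted S r ∨
      covered (E (r, n)) x.1 x.2 = true) = {z | ∀ R, rho R = rho S → z ∈ rect fun x => U R (n, x)} := by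
    intro S n
    ext z
    constructor
    · rintro ⟨x, ⟨N, hN⟩, h1, h2⟩ R hR
      rcases hN (PiNat.res R N) (mem_words.2 (PiNat.res_length _ _)) with h | h
      · exact absurd h (not_refuted hR N)
      · obtain ⟨p, hp, h3, h4⟩ := covered_iff.1 h
        exact ⟨p, (hEP _ _ _).2 ⟨N, hp⟩, cyl_subset_of_suffix h3 h1, cyl_subset_of_suffix h4 h2⟩
    · intro hz
      -- Compactness: every real is either refuted at some stage or, being a representation,
      -- enumerates a rectangle around `z`. The open sets increase with the stage, so one stage
      -- serves all reals.
      obtain ⟨N, hN⟩ : ∃ N, (Set.univ : Set Cantor) ⊆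
          {R | Refuted S (PiNat.res R N) ∨ z ∈ boxes (E (PiNat.res R N, n))} := by
        refine isCompact_univ.elim_directed_cover _
          (fun N => isOpen_setOf_res (fun r => Refuted S r ∨ z ∈ boxes (E (r, n))) N)
          (fun R _ => ?_) (directed_of_isDirected_le ?_)
        · rw [Set.mem_iUnion]
          by_cases hR : rho R = rho S
          · obtain ⟨x, h1, h2⟩ := hz R hR
            obtain ⟨N, hN⟩ := (hEP _ _ _).1 h1
            exact ⟨N, Or.inr (mem_boxes.2 ⟨x, hN, h2⟩)⟩
          · obtain ⟨N, hN⟩ := exists_refuted hR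
            exact ⟨N, Or.inl hN⟩
        · rintro i j hij R (h | h)
          · exact Or.inl (h.mono (res_suffix_res R hij))
          · obtain ⟨x, h1, h2⟩ := mem_boxes.1 h
            exact Or.inr (mem_boxes.2 ⟨x, hEmono _ _ _ _ hij _ h1, h2⟩)
      -- At length `M`, no shorter than any word enumerated from the words `r`, membership in each
      -- finite union is decided by the initial segments of `z`.
      let M := ((words N).map fun r => maxLen (E (r, n))).sum
      refine ⟨(PiNat.res z.1 M, PiNat.res z.2 M), ⟨N, fun r hr => ?_⟩, mem_cyl_res _ _,
        mem_cyl_res _ _⟩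
      obtain ⟨R, hR⟩ := exists_res_eq r
      rw [mem_words.1 hr] at hR
      have hM : maxLen (E (r, n)) ≤ M :=
        List.le_sum_of_mem (List.mem_map_of_mem (f := fun r => maxLen (E (r, n))) hr)
      rcases hN (Set.mem_univ R) with h | h
      · exact Or.inl (hR ▸ h)
      · rw [hR] at h
        exact Or.inr ((mem_boxes_iff_covered hM hM).1 h)
  refine ⟨_, hP, ?_, fun S n => ?_, fun S S' h n => ?_, fun S z hz n => ?_⟩
  · rintro S n σ σ' τ hσ ⟨N, hN⟩
    refine ⟨N, fun r hr => (hN r hr).imp id fun h => ?_⟩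
    obtain ⟨p, hp, h1, h2⟩ := covered_iff.1 h
    exact covered_iff.2 ⟨p, hp, h1.trans hσ, h2⟩
  · refine (measure_mono ?_).trans (hUμ S n)
    rw [key]
    -- `S` is one of the representations over which the intersection is taken.
    exact fun z hz => hz S rfl
  · rw [key, key, h]
  · rw [key]
    intro R hR
    by_contra hc
    refine hz ⟨R, hR, fun V hV hzV => hc (hUuniv R V hV z hzV n)⟩

/-! ### Van Lambalgen's theorem -/

/-- Continuity from below along a finite exhaustion: a large measure of an open set has a finite
witness. -/
lemma exists_list_lt_measure (ν : Measure Cantor) {p : List Bool → Prop} {c : ENNReal}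
    (h : c < ν {Y | ∃ τ, p τ ∧ Y ∈ cyl τ}) :
    ∃ l : List (List Bool), (∀ τ ∈ l, p τ) ∧ c < ν (cyls l) := by
  classical
  have hU : {Y | ∃ τ, p τ ∧ Y ∈ cyl τ} =
      ⋃ j, cyls ((below (List Bool) j).filter fun τ => decide (p τ)) := by
    ext Y
    simp only [Set.mem_ofPred_eq, Set.mem_iUnion, mem_cyls, List.mem_filter, decide_eq_true_eq]
    constructor
    · rintro ⟨τ, h1, h2⟩
      exact ⟨_, τ, ⟨mem_below (Nat.lt_succ_self _), h1⟩, h2⟩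
    · rintro ⟨j, τ, ⟨-, h1⟩, h2⟩
      exact ⟨τ, h1, h2⟩
  have hmono : Monotone fun j => cyls ((below (List Bool) j).filter fun τ => decide (p τ)) := by
    intro i j hij Y
    simp only [mem_cyls, List.mem_filter]
    rintro ⟨τ, ⟨h1, h2⟩, h3⟩
    exact ⟨τ, ⟨below_mono hij h1, h2⟩, h3⟩
  rw [hU, hmono.measure_iUnion, lt_iSup_iff] at h
  obtain ⟨j, hj⟩ := h
  exact ⟨_, fun τ hτ => by simpa using (List.mem_filter.1 hτ).2, hj⟩

/-- Markov's inequality for the measure of the section. Half of the exponent `2 * n` goes into the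
threshold, the other half is the bound. -/
lemma measure_section_le (μ : Measure Cantor) [IsProbabilityMeasure μ] {V : Set (Cantor × Cantor)}
    (hV : IsOpen V) {n : ℕ} (h : (μ.prod μ) V ≤ 2⁻¹ ^ (2 * n)) :
    μ {X | 2⁻¹ ^ n < μ {Y | (X, Y) ∈ V}} ≤ 2⁻¹ ^ n := by
  have h1 := mul_meas_ge_le_lintegral₀ (μ := μ) (f := fun X => μ (Prod.mk X ⁻¹' V))
    (measurable_measure_prodMk_left hV.measurableSet).aemeasurable (2⁻¹ ^ n)
  rw [← Measure.prod_apply hV.measurableSet] at h1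
  have h2 : (2⁻¹ : ENNReal) ^ n * μ {X | 2⁻¹ ^ n < μ {Y | (X, Y) ∈ V}} ≤ 2⁻¹ ^ n * 2⁻¹ ^ n := by
    rw [← pow_add, ← two_mul]
    refine le_trans ?_ (h1.trans h)
    gcongr
    exact fun hX => hX.le
  exact (ENNReal.mul_le_mul_iff_right (by simp) (by simp)).1 h2

/-- The sections of an effectively open set with large measure form an effectively open set. -/
lemma ce_section {P : Cantor → ℕ × (List Bool × List Bool) → Prop} (hP : CE P) :
    CE fun S (y : ℕ × List Bool) => ∃ l : List (List Bool),
      (∀ τ ∈ l, P S (2 * y.1, (y.2, τ))) ∧ (2⁻¹ : ENNReal) ^ y.1 < (rho S : Measure Cantor) (cyls l) := by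
  have h1 : Primrec fun y : ((ℕ × List Bool) × List (List Bool)) × List Bool =>
      (2 * y.1.1.1, (y.1.1.2, y.2)) :=
    (Primrec.nat_mul.comp (Primrec.const 2) (Primrec.fst.comp (Primrec.fst.comp Primrec.fst))).pair
      ((Primrec.snd.comp (Primrec.fst.comp Primrec.fst)).pair Primrec.snd)
  have h2 : Primrec fun y : (ℕ × List Bool) × List (List Bool) => (y.2, y.1.1) :=
    Primrec.snd.pair (Primrec.fst.comp Primrec.fst)
  exact (((hP.comp h1).forall_mem (l := fun y => y.2) Primrec.snd).and (ce_lt_rho.comp h2)).exists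

/-- Finitely many `τ` witness that the section is large, each with its own initial segment of `X`.
Monotonicity in the first word allows the longest of these to be used for all. -/
lemma exists_section_iff {P : Cantor → ℕ × (List Bool × List Bool) → Prop}
    (hP : ∀ S n σ σ' τ, σ <:+ σ' → P S (n, (σ, τ)) → P S (n, (σ', τ))) (S : Cantor) (n : ℕ)
    (X : Cantor) :
    (∃ σ, (∃ l : List (List Bool), (∀ τ ∈ l, P S (2 * n, (σ, τ))) ∧
      (2⁻¹ : ENNReal) ^ n < (rho S : Measure Cantor) (cyls l)) ∧ X ∈ cyl σ) ↔
    (2⁻¹ : ENNReal) ^ n < (rho S : Measure Cantor) {Y | (X, Y) ∈ rect fun x => P S (2 * n, x)} := by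
  constructor
  · rintro ⟨σ, ⟨l, h1, h2⟩, h3⟩
    refine h2.trans_le (measure_mono fun Y hY => ?_)
    obtain ⟨τ, h4, h5⟩ := mem_cyls.1 hY
    exact ⟨(σ, τ), h1 τ h4, h3, h5⟩
  · intro h
    have e : {Y | (X, Y) ∈ rect fun x => P S (2 * n, x)} =
        {Y | ∃ τ, (∃ i, P S (2 * n, (PiNat.res X i, τ))) ∧ Y ∈ cyl τ} := by
      ext Y
      constructor
      · rintro ⟨⟨σ, τ⟩, h1, h2, h3⟩
        obtain ⟨i, rfl⟩ := mem_cyl_iff.1 h2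
        exact ⟨τ, ⟨i, h1⟩, h3⟩
      · rintro ⟨τ, ⟨i, h1⟩, h2⟩
        exact ⟨(PiNat.res X i, τ), h1, mem_cyl_res X i, h2⟩
    rw [e] at h
    obtain ⟨l, h1, h2⟩ := exists_list_lt_measure _ h
    have : ∃ i, ∀ τ ∈ l, P S (2 * n, (PiNat.res X i, τ)) := by
      clear h2
      induction l with
      | nil => exact ⟨0, by simp⟩
      | cons τ l ih =>
        obtain ⟨i, hi⟩ := ih fun τ hτ => h1 τ (List.mem_cons_of_mem _ hτ)
        obtain ⟨j, hj⟩ := h1 τ List.mem_cons_self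
        refine ⟨max i j, fun τ' hτ' => ?_⟩
        rcases List.mem_cons.1 hτ' with rfl | hτ'
        · exact hP _ _ _ _ _ (res_suffix_res X (le_max_right _ _)) hj
        · exact hP _ _ _ _ _ (res_suffix_res X (le_max_left _ _)) (hi _ hτ')
    obtain ⟨i, hi⟩ := this
    exact ⟨_, ⟨l, hi, h2⟩, mem_cyl_res X i⟩

/-- `A` is used with the representation `R` to bound the sections over `A`, and `B` with `S` to
contradict the capture of the pair. The extensional test lets the bound pass from `R` to `S`. -/
lemma mem_mLRProd_of_relativelyRandom {μ : ProbabilityMeasure Cantor} {A B : Cantor}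
    (h : RelativelyRandom μ A B) : (A, B) ∈ MLRProd μ := by
  obtain ⟨⟨R, rfl, hA⟩, ⟨S, hS, hB⟩⟩ := h
  by_contra hAB
  obtain ⟨P, hP, hPmono, hPμ, hPext, hPcapture⟩ := exists_extensional_test
  -- A Borel–Cantelli argument: the `n`-th set of the test for `A` collects the points with a large
  -- section at any level `n + m + 1`. Its measure is at most the sum of `2⁻¹ ^ (n + m + 1)`, that
  -- is `2⁻¹ ^ n`, and `n₀` is the index of a set that omits `A`.
  obtain ⟨n₀, hn₀⟩ : ∃ n₀, ∀ m, (rho R : Measure Cantor)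
      {Y | (A, Y) ∈ rect fun x => P R (2 * (n₀ + m + 1), x)} ≤ 2⁻¹ ^ (n₀ + m + 1) := by
    have hs : Primrec fun y : (ℕ × List Bool) × ℕ => (y.1.1 + y.2 + 1, y.1.2) :=
      (Primrec.succ.comp (Primrec.nat_add.comp (Primrec.fst.comp Primrec.fst) Primrec.snd)).pair
        (Primrec.snd.comp Primrec.fst)
    have hG := (((ce_section hP).comp hs).exists.comp_half 0).uniformlySigmaOne (join R B)
    simp only [half_zero_join] at hG
    have hmem : ∀ n X, (∃ σ, (∃ m, ∃ l : List (List Bool),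
        (∀ τ ∈ l, P R (2 * (n + m + 1), (σ, τ))) ∧
        (2⁻¹ : ENNReal) ^ (n + m + 1) < (rho R : Measure Cantor) (cyls l)) ∧ X ∈ cyl σ) ↔
        ∃ m, (2⁻¹ : ENNReal) ^ (n + m + 1) <
          (rho R : Measure Cantor) {Y | (X, Y) ∈ rect fun x => P R (2 * (n + m + 1), x)} := by
      intro n X
      simp only [← exists_section_iff hPmono]
      constructor
      · rintro ⟨σ, ⟨m, h1⟩, h2⟩
        exact ⟨m, σ, h1, h2⟩
      · rintro ⟨m, σ, h1, h2⟩
        exact ⟨σ, ⟨m, h1⟩, h2⟩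
    have := hA _ ⟨hG, fun n => ?_⟩
    · simp only [Set.mem_iInter, not_forall, Set.mem_ofPred_eq, hmem, not_exists, not_lt] at this
      exact this
    · rw [← tsum_two_inv_pow]
      refine (measure_mono fun X hX => ?_).trans ((measure_iUnion_le fun m =>
        {X | (2⁻¹ : ENNReal) ^ (n + m + 1) <
          (rho R : Measure Cantor) {Y | (X, Y) ∈ rect fun x => P R (2 * (n + m + 1), x)}}).trans
        (ENNReal.tsum_le_tsum fun m => measure_section_le _ (isOpen_rect _) (hPμ R _)))
      exact Set.mem_iUnion.2 ((hmem n X).1 hX)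
  -- The oracle `A` decides which first words are initial segments of `A`, and `S` enumerates the
  -- rectangles.
  have hH : UniformlySigmaOne (join S A) fun n =>
      {Y | (A, Y) ∈ rect fun x => P S (2 * (n₀ + n + 1), x)} := by
    have h1 : Primrec fun y : (ℕ × List Bool) × List Bool => y.2.length :=
      Primrec.list_length.comp Primrec.snd
    have h2 : Primrec fun y : (ℕ × List Bool) × List Bool =>
        (2 * (n₀ + y.1.1 + 1), (y.2, y.1.2)) :=
      (Primrec.nat_mul.comp (Primrec.const 2) (Primrec.succ.comp (Primrec.nat_add.comp
        (Primrec.const n₀) (Primrec.fst.comp Primrec.fst)))).pair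
        (Primrec.snd.pair (Primrec.snd.comp Primrec.fst))
    convert ((((CE.res_eq h1 Primrec.snd).comp_half 1).and
      ((hP.comp h2).comp_half 0)).exists).uniformlySigmaOne (join S A) using 1
    funext n
    ext Y
    simp only [half_zero_join, half_one_join, Set.mem_ofPred_eq, rect]
    constructor
    · rintro ⟨⟨σ, τ⟩, h1, h2, h3⟩
      exact ⟨τ, ⟨σ, h2, h1⟩, h3⟩
    · rintro ⟨τ, ⟨σ, h2, h1⟩, h3⟩
      exact ⟨(σ, τ), h1, h2, h3⟩
  refine hB _ ⟨hH, fun n => ?_⟩ (Set.mem_iInter.2 fun n => ?_)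
  -- The sections enumerated from `S` are those enumerated from `R`, so the bound obtained from the
  -- randomness of `A` applies.
  · rw [hS, hPext S R hS]
    exact (hn₀ n).trans (pow_le_pow_right_of_le_one' (by simp) (by omega))
  · simp only [hPext S R hS]
    exact hPcapture R _ hAB _

end CantorRandom

theorem mainTheorem8 (μ : MeasureTheory.ProbabilityMeasure CantorRandom.Cantor)
    (A B : CantorRandom.Cantor) :
    CantorRandom.RelativelyRandom μ A B ↔ (A, B) ∈ CantorRandom.MLRProd μ :=
  ⟨CantorRandom.mem_mLRProd_of_relativelyRandom, CantorRandom.relativelyRandom_of_mem_mLRProd⟩
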